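/- Fix $\ell\ge 2$. For a finite set $M$ of $m=|M|\ge 1$ candidates, a top-$\ell$ ranking is a linear order on an $\ell$-element subset of $M$, and a profile is a finite sequence of top-$\ell$ rankings (votes). A (resolute) voting rule $r_\ell$ maps, for every such $M$, each profile over $M$ to a candidate in $M$, the winner; it is anonymous if permuting the votes of a profile never changes the winner. In the problem WAV-$r_\ell$ (winner with absent votes), the input consists of $M$, a profile $P$ of known votes, a number $t\ge 0$ of absent votes, and a candidate $c\in M$; the question is whether there is a profile $P'$ of exactly $t$ top-$\ell$ rankings such that $r_\ell(P\cup P')=c$, where $P\cup P'$ is the profile of all votes in $P$ and $P'$. Candidates and votes are listed explicitly in the input, and $t$ is given in unary. Let $r_\ell$ be an anonymous voting rule such that the winner $r_\ell(P)$ can be computed in time polynomial in the size of the input $(M,P)$. Then: 1. for every fixed $m\ge 2$, WAV-$r_\ell$ restricted to $m$ candidates (where $m$ is a constant and not part of the input) can be solved in polynomial time; 2. for every fixed $t\ge 0$, WAV-$r_\ell$ with $t$ absent votes (where $t$ is a constant and not part of the input) can be solved in polynomial time. -/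

import Mathlib

open Computability

/-- A top-`ℓ` ranking of the candidate set `{0, …, m - 1}`: a linear order on an `ℓ`-subset,
given by the candidate `v i` in each position `i` (position `0` is the most preferred one). -/
abbrev TopRanking (ℓ m : ℕ) : Type := Fin ℓ ↪ Fin m

/-- A profile is the vector of the votes of all voters. -/
abbrev Profile (ℓ m : ℕ) : Type := List (TopRanking ℓ m)

/-- A resolute voting rule for top-`ℓ` rankings: for every nonempty finite set of candidates,
a map from profiles (with any number of votes) to candidates. -/
abbrev VotingRule (ℓ : ℕ) : Type := (m : ℕ+) → Profile ℓ m → Fin m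

namespace VotingRule

variable {ℓ : ℕ}

/-- A rule is anonymous if permuting the voters never changes the winner. -/
def Anonymous (r : VotingRule ℓ) : Prop :=
  ∀ (m : ℕ+) (P Q : Profile ℓ m), P.Perm Q → r m P = r m Q

/-- The question of "winner with absent votes": can `t` further votes be cast such that
`c` wins under `r`, given the profile `P` of known votes? -/
def WAV (r : VotingRule ℓ) (m : ℕ+) (P : Profile ℓ m) (t : ℕ) (c : Fin m) : Prop :=
  ∃ P' : Profile ℓ m, P'.length = t ∧ r m (P ++ P') = c

end VotingRule

/-- A natural number in unary, followed by an end marker. -/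
def encodeField (n : ℕ) : List Bool := unaryEncodeNat n ++ [false]

/-- A vote is written as the list of its `ℓ` candidates, in order of preference. -/
def encodeVote {ℓ m : ℕ} (v : TopRanking ℓ m) : List Bool :=
  (List.ofFn v).flatMap fun c : Fin m => encodeField c

/-- A profile is written vote by vote. -/
def encodeProfile {ℓ m : ℕ} (P : Profile ℓ m) : List Bool := P.flatMap encodeVote

/-- An election consists of a set of candidates and a profile. -/
abbrev Election (ℓ : ℕ) : Type := (m : ℕ+) × Profile ℓ m

/-- The candidate set takes `m + 1` symbols; as listing its elements takes at least `m` symbols,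
this is polynomially equivalent to any reasonable explicit encoding of the candidates. -/
def encodeElection {ℓ : ℕ} (E : Election ℓ) : List Bool :=
  encodeField E.1 ++ encodeProfile E.2

/-- An instance with a fixed number `m` of candidates: the known votes, the number of absent votes
and the target candidate. -/
structure FixedCandidatesInstance (ℓ : ℕ) (m : ℕ+) where
  known : Profile ℓ m
  absent : ℕ
  target : Fin m

/-- The number of absent votes is written in unary. -/
def FixedCandidatesInstance.encode {ℓ : ℕ} {m : ℕ+} (I : FixedCandidatesInstance ℓ m) :
    List Bool :=
  encodeField I.absent ++ encodeField I.target ++ encodeProfile I.known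

/-- An instance with a fixed number of absent votes: the candidates, the known votes and the
target candidate. -/
structure FixedAbsentInstance (ℓ : ℕ) where
  candidates : ℕ+
  known : Profile ℓ candidates
  target : Fin candidates

def FixedAbsentInstance.encode {ℓ : ℕ} (I : FixedAbsentInstance ℓ) : List Bool :=
  encodeField I.candidates ++ encodeField I.target ++ encodeProfile I.known

open scoped Classical in
/-- A decision problem, with instances written as words, is solved by a Turing machine whose
running time is bounded by a polynomial in the length of the input. -/
def PolyTimeSolvable {α : Type} (enc : α → List Bool) (p : α → Prop) : Prop :=
  Nonempty (Turing.TM2ComputableInPolyTime enc encodeBool fun a => decide (p a))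

namespace VotingRule

variable {ℓ : ℕ}

/-- The (index of the) winner of an election is computed by a polynomial-time Turing machine to
which both the candidate set and the profile are given as input. -/
def PolyTimeComputable (r : VotingRule ℓ) : Prop :=
  Nonempty (Turing.TM2ComputableInPolyTime (encodeElection (ℓ := ℓ)) unaryEncodeNat
    fun E => (r E.1 E.2 : ℕ))

end VotingRule

/-!
By anonymity, only the multiplicities of the rankings among the absent votes matter. For a fixed
number of candidates there are at most `(t + 1) ^ N` vectors of multiplicities, where `N` is the
number of rankings; for a fixed number `t` of absent votes there are at most `m ^ (t * ℓ)` profiles.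
Both searches run through the vectors of a fixed number of unary counters that are bounded by a
number from the input, and there are only polynomially many of them. Each vector that describes a
profile of `t` votes is turned into an election, on which the machine for the voting rule is run as
a subroutine.
-/

namespace StackProgram

open Turing Turing.TM2 Function StateTransition

section Reaches

variable {K K' : Type} [DecidableEq K] [DecidableEq K'] {Γ : K → Type} {Γ' : K' → Type}
  {Λ Λ' σ σ' : Type}

/-- The stack machine with code `M` gets from `c` to `c'` within `n` steps. -/
def Reaches (M : Λ → Stmt Γ Λ σ) (c c' : Cfg Γ Λ σ) (n : ℕ) : Prop :=
  Nonempty (EvalsToInTime (step M) c (some c') n)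

variable {M : Λ → Stmt Γ Λ σ} {M' : Λ' → Stmt Γ' Λ' σ'} {c c' c'' : Cfg Γ Λ σ} {n n' : ℕ}

theorem Reaches.of_step {l : Λ} {v : σ} {S : ∀ k, List (Γ k)} (h : stepAux (M l) v S = c') :
    Reaches M ⟨some l, v, S⟩ c' 1 :=
  ⟨⟨⟨1, congrArg some h⟩, le_rfl⟩⟩

theorem Reaches.mono (h : Reaches M c c' n) (hn : n ≤ n') : Reaches M c c' n' :=
  h.map fun e => ⟨e.toEvalsTo, e.steps_le_m.trans hn⟩

theorem Reaches.trans (h : Reaches M c c' n) (h' : Reaches M c' c'' n') :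
    Reaches M c c'' (n + n') := by
  rw [Nat.add_comm]
  exact h.map2 (fun e e' => e.trans _ _ _ _ _ _ e') h'

theorem Reaches.map (φ : Cfg Γ Λ σ → Cfg Γ' Λ' σ')
    (hφ : ∀ l v S, step M' (φ ⟨some l, v, S⟩) = some (φ (stepAux (M l) v S)))
    (h : Reaches M c c' n) : Reaches M' (φ c) (φ c') n := by
  obtain ⟨⟨⟨j, hj⟩, hn⟩⟩ := h
  refine ⟨⟨⟨j, ?_⟩, hn⟩⟩
  clear hn
  induction j generalizing c' with
  | zero => exact congrArg (Option.map φ) hj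
  | succ j ih =>
    rw [iterate_succ_apply'] at hj ⊢
    obtain ⟨⟨_ | l, v, S⟩, hd, hs⟩ := Option.bind_eq_some_iff.1 hj
    · cases hs
    · rw [ih hd, ← Option.some.inj hs]
      exact hφ l v S

end Reaches

section MapLabels

variable {K : Type} {Γ : K → Type} {σ Λ Λ' : Type}

/-- Rename the labels of a statement by `g` and replace halting by a jump to `e`
(if `e` is a label). -/
def mapLabels (g : Λ → Λ') (e : Option Λ') : Stmt Γ Λ σ → Stmt Γ Λ' σ
  | .push k f q => .push k f (mapLabels g e q)
  | .peek k f q => .peek k f (mapLabels g e q)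
  | .pop k f q => .pop k f (mapLabels g e q)
  | .load f q => .load f (mapLabels g e q)
  | .branch f q q' => .branch f (mapLabels g e q) (mapLabels g e q')
  | .goto f => .goto fun v => g (f v)
  | .halt => e.elim .halt fun l => .goto fun _ => l

/-- The effect of `mapLabels` on configurations. -/
def mapLabelsCfg (g : Λ → Λ') (e : Option Λ') (c : Cfg Γ Λ σ) : Cfg Γ Λ' σ :=
  ⟨c.l.elim e fun l => some (g l), c.var, c.stk⟩

variable [DecidableEq K]

theorem stepAux_mapLabels (g : Λ → Λ') (e : Option Λ') (q : Stmt Γ Λ σ) (v : σ)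
    (S : ∀ k, List (Γ k)) :
    stepAux (mapLabels g e q) v S = mapLabelsCfg g e (stepAux q v S) := by
  induction q generalizing v S with
  | branch f q q' ih ih' => cases h : f v <;> simp [mapLabels, h, ih, ih']
  | goto f => rfl
  | halt => cases e <;> rfl
  | _ => simp only [mapLabels, stepAux, *]

theorem Reaches.mapLabels {M : Λ → Stmt Γ Λ σ} {M' : Λ' → Stmt Γ Λ' σ} (g : Λ → Λ')
    (e : Option Λ') (hM : ∀ l, M' (g l) = StackProgram.mapLabels g e (M l)) {n : ℕ}
    {c c' : Cfg Γ Λ σ} (h : Reaches M c c' n) :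
    Reaches M' (mapLabelsCfg g e c) (mapLabelsCfg g e c') n :=
  h.map _ fun l v S => congrArg some <| by rw [hM, stepAux_mapLabels]

end MapLabels

/-- A piece of code for a stack machine; it is entered at `main` and left by halting. -/
structure Fragment {K : Type} (Γ : K → Type) (σ : Type) where
  Λ : Type
  [fin : Fintype Λ]
  main : Λ
  code : Λ → Stmt Γ Λ σ

attribute [instance] Fragment.fin

namespace Fragment

variable {K : Type} {Γ : K → Type} {σ ι : Type} [Fintype ι]

/-- A fragment that consists of a single statement, which does not jump. -/
def single (q : Stmt Γ Unit σ) : Fragment Γ σ where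
  Λ := Unit
  main := ()
  code _ := q

/-- Sequential composition. -/
def seq (A B : Fragment Γ σ) : Fragment Γ σ where
  Λ := A.Λ ⊕ B.Λ
  main := .inl A.main
  code := Sum.elim (fun l => mapLabels .inl (some (.inr B.main)) (A.code l))
    fun l => mapLabels .inr none (B.code l)

/-- Execute the statement `q`, which ends with a jump to the body with a given index or with
halting; after a body, continue with `q` again if `again` is set, and halt otherwise. -/
def control (q : Stmt Γ ι σ) (A : ι → Fragment Γ σ) (again : Bool) : Fragment Γ σ where
  Λ := Option (Σ i, (A i).Λ)
  main := none
  code := fun l => l.elim (mapLabels (fun i => some ⟨i, (A i).main⟩) none q)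
    fun l => mapLabels (fun l' => some ⟨l.1, l'⟩) (if again then some none else none)
      ((A l.1).code l.2)

/-- Move the stack `k` to the stack `k'`, in reverse order, translating symbols to bits by `read`
and bits to symbols by `write`. -/
def transfer {τ : Type} {Γ : K → Type} (k k' : K) (read : Γ k → Bool) (write : Bool → Γ k') :
    Fragment Γ (Option Bool × τ) where
  Λ := Unit
  main := ()
  code _ := .pop k (fun v o => (o.map read, v.2)) <| .branch (fun v => v.1.isSome)
    (.push k' (fun v => write (v.1.getD false)) (.goto fun _ => ())) .halt

variable [DecidableEq K]

/-- Starting in state `v` with stacks `S`, the fragment halts within `n` steps in state `v'` with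
stacks `S'`. -/
def Executes (A : Fragment Γ σ) (v : σ) (S : ∀ k, List (Γ k)) (v' : σ) (S' : ∀ k, List (Γ k))
    (n : ℕ) : Prop :=
  Reaches A.code ⟨some A.main, v, S⟩ ⟨none, v', S'⟩ n

variable {v v' v'' : σ} {S S' S'' : ∀ k, List (Γ k)} {n n' : ℕ}

theorem executes_single {q : Stmt Γ Unit σ} (h : stepAux q v S = ⟨none, v', S'⟩) :
    (single q).Executes v S v' S' 1 :=
  .of_step h

theorem Executes.seq {A B : Fragment Γ σ} (hA : A.Executes v S v' S' n)
    (hB : B.Executes v' S' v'' S'' n') : (A.seq B).Executes v S v'' S'' (n + n') :=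
  (hA.mapLabels (M' := (A.seq B).code) .inl (some (.inr B.main)) fun _ => rfl).trans
    (hB.mapLabels (M' := (A.seq B).code) .inr none fun _ => rfl)

variable {q : Stmt Γ ι σ} {A : ι → Fragment Γ σ}

theorem executes_control_halt {again : Bool} (h : stepAux q v S = ⟨none, v', S'⟩) :
    (control q A again).Executes v S v' S' 1 :=
  .of_step <| (stepAux_mapLabels _ _ q v S).trans <| congrArg (mapLabelsCfg _ _) h

theorem reaches_control_body {again : Bool} {i : ι} (h : stepAux q v S = ⟨some i, v', S'⟩)
    (hA : (A i).Executes v' S' v'' S'' n) :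
    Reaches (control q A again).code ⟨some (control q A again).main, v, S⟩
      ⟨if again then some none else none, v'', S''⟩ (n + 1) := by
  have jump : Reaches (control q A again).code ⟨some (control q A again).main, v, S⟩
      ⟨some (some ⟨i, (A i).main⟩), v', S'⟩ 1 :=
    .of_step <| (stepAux_mapLabels _ _ q v S).trans <| congrArg (mapLabelsCfg _ _) h
  rw [Nat.add_comm]
  exact jump.trans
    (hA.mapLabels (M' := (control q A again).code) (fun l => some ⟨i, l⟩) _ fun _ => rfl)

theorem executes_transfer {τ : Type} {k k' : K} (hk : k ≠ k') (read : Γ k → Bool)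
    (write : Bool → Γ k') (b : Option Bool) (v : τ) (S : ∀ k, List (Γ k)) :
    (transfer k k' read write).Executes (b, v) S (none, v)
      (update (update S k []) k' ((S k).reverse.map (write ∘ read) ++ S k'))
      ((S k).length + 1) := by
  generalize hl : S k = l
  induction l generalizing S b with
  | nil =>
    refine .of_step ?_
    rw [← hl, update_eq_self, hl, List.reverse_nil, List.map_nil, List.nil_append, update_eq_self]
    simp [transfer, hl]
  | cons x l ih =>
    have first : Reaches (transfer (τ := τ) k k' read write).code ⟨some (), (b, v), S⟩
        ⟨some (), (some (read x), v), update (update S k l) k' (write (read x) :: S k')⟩ 1 :=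
      .of_step (by simp [transfer, hl, hk.symm])
    have rest := ih (some (read x)) (update (update S k l) k' (write (read x) :: S k'))
      (by rw [update_of_ne hk, update_self])
    rw [update_comm (β := fun k => List (Γ k)) hk.symm, update_idem, update_idem, update_self]
      at rest
    rw [List.length_cons, Nat.add_comm]
    simpa [Executes, transfer] using first.trans rest

end Fragment

section Programs

variable {K : Type} {M : FinTM2}

/-- Boolean registers indexed by `K`, next to the stacks of the machine `M`. -/
@[reducible] def stackAlphabet (K : Type) (M : FinTM2) : K ⊕ M.K → Type
  | .inl _ => Bool
  | .inr k => M.Γ k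

/-- A program with registers in `K` that may use `M` as a subroutine. Its own state is a
single optional bit, which holds the symbol read last. -/
abbrev Program (K : Type) (M : FinTM2) : Type 1 :=
  Fragment (stackAlphabet K M) (Option Bool × M.σ)

/-- The stacks of a program, made up of its registers and of the stacks of its subroutine. -/
def joinStacks (T : K → List Bool) (U : ∀ k, List (M.Γ k)) : ∀ k, List (stackAlphabet K M k)
  | .inl k => T k
  | .inr k => U k

/-- The stacks of a machine that is not in use. -/
def emptyStacks (M : FinTM2) : ∀ k, List (M.Γ k) := fun _ => []

@[simp] theorem joinStacks_inl (T : K → List Bool) (U : ∀ k, List (M.Γ k)) (k : K) :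
    joinStacks T U (.inl k) = T k := rfl

@[simp] theorem joinStacks_inr (T : K → List Bool) (U : ∀ k, List (M.Γ k)) (k : M.K) :
    joinStacks T U (.inr k) = U k := rfl

variable [DecidableEq K]

@[simp] theorem update_joinStacks_inl (T : K → List Bool) (U : ∀ k, List (M.Γ k)) (k : K)
    (l : List Bool) :
    update (joinStacks T U) (.inl k) l = joinStacks (update T k l) U := by
  funext k'
  rcases k' with k' | k'
  · obtain rfl | h := eq_or_ne k' k <;> simp [*]
  · simp

@[simp] theorem update_joinStacks_inr (T : K → List Bool) (U : ∀ k, List (M.Γ k)) (k : M.K)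
    (l : List (M.Γ k)) :
    update (joinStacks T U) (.inr k) l = joinStacks T (update U k l) := by
  funext k'
  rcases k' with k' | k'
  · simp
  · obtain rfl | h := eq_or_ne k' k <;> simp [*]

/-- The program transforms the registers from `T` to `T'` within `n` steps, and leaves the
subroutine `M` in its initial state, with empty stacks. -/
def Runs (A : Program K M) (T T' : K → List Bool) (n : ℕ) : Prop :=
  ∀ b, ∃ b', A.Executes (b, M.initialState) (joinStacks T (emptyStacks M))
    (b', M.initialState) (joinStacks T' (emptyStacks M)) n

variable {A B : Program K M} {T T' T'' : K → List Bool} {n n' : ℕ}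

theorem Runs.mono (h : Runs A T T' n) (hn : n ≤ n') : Runs A T T' n' := fun b =>
  let ⟨b', hb⟩ := h b
  ⟨b', Reaches.mono hb hn⟩

theorem Runs.seq (hA : Runs A T T' n) (hB : Runs B T' T'' n') :
    Runs (A.seq B) T T'' (n + n') := fun b =>
  let ⟨b', h⟩ := hA b
  let ⟨b'', h'⟩ := hB b'
  ⟨b'', h.seq h'⟩

/-- The program that does nothing. -/
def skip : Program K M := Fragment.single .halt

theorem runs_skip (T : K → List Bool) : Runs (M := M) skip T T 1 := fun b =>
  ⟨b, Fragment.executes_single rfl⟩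

/-- Push the symbol `x` onto the register `k`. -/
def push (k : K) (x : Bool) : Program K M := Fragment.single (.push (.inl k) (fun _ => x) .halt)

theorem runs_push (k : K) (x : Bool) (T : K → List Bool) :
    Runs (M := M) (push k x) T (update T k (x :: T k)) 1 := fun b =>
  ⟨b, Fragment.executes_single (by simp)⟩

/-- Pop the top symbol of the register `k` and continue with the program indexed by it. -/
def popCase (k : K) (A : Option Bool → Program K M) : Program K M :=
  Fragment.control (.pop (.inl k) (fun v o => (o, v.2)) (.goto fun v => v.1)) A false

theorem runs_popCase {k : K} {A : Option Bool → Program K M}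
    (h : Runs (A (T k).head?) (update T k (T k).tail) T' n) :
    Runs (popCase k A) T T' (n + 1) := fun _ =>
  let ⟨b', h'⟩ := h (T k).head?
  ⟨b', Fragment.reaches_control_body (i := (T k).head?) (by simp) h'⟩

/-- Pop symbols off the register `k` and execute the programs indexed by them, until `mark` is
reached; `mark = none` stands for an empty register. -/
def loop (k : K) (mark : Option Bool) (A : Bool → Program K M) : Program K M :=
  Fragment.control (.pop (.inl k) (fun v o => (o, v.2))
    (.branch (fun v => v.1 == mark) .halt (.goto fun v => v.1.getD false))) A true

variable {k : K} {mark : Option Bool} {A : Bool → Program K M}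

theorem runs_loop_nil (h : (T k).head? = mark) :
    Runs (loop k mark A) T (update T k (T k).tail) 1 := fun _ =>
  ⟨(T k).head?, Fragment.executes_control_halt (by simp [h])⟩

theorem runs_loop_cons {x : Bool} {l : List Bool} (h : T k = x :: l) (hx : some x ≠ mark)
    (hA : Runs (A x) (update T k l) T' n) (hB : Runs (loop k mark A) T' T'' n') :
    Runs (loop k mark A) T T'' (n + 1 + n') := fun _ =>
  have hmark : (some x == mark) = false := beq_false_of_ne hx
  let ⟨b', h'⟩ := hA (some x)
  let ⟨b'', h''⟩ := hB b'
  ⟨b'', (Fragment.reaches_control_body (i := x) (by simp [h, hmark]) h').trans h''⟩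

theorem runs_loop {L rest : List Bool} {S : ℕ → K → List Bool}
    (hS : ∀ j ≤ L.length, S j k = L.drop j ++ rest) (hL : ∀ x ∈ L, some x ≠ mark)
    (hrest : rest.head? = mark)
    (h : ∀ j (hj : j < L.length),
      Runs (A L[j]) (update (S j) k (L.drop (j + 1) ++ rest)) (S (j + 1)) n) :
    Runs (loop k mark A) (S 0) (update (S L.length) k rest.tail) (L.length * (n + 1) + 1) := by
  induction L generalizing S with
  | nil =>
    have h₀ : S 0 k = rest := hS 0 le_rfl
    have ended := runs_loop_nil (A := A) (T := S 0) (h₀ ▸ hrest)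
    rw [h₀] at ended
    simpa using ended
  | cons x L ih =>
    have tail := ih (S := fun j => S (j + 1)) (fun j hj => hS (j + 1) (Nat.succ_le_succ hj))
      (fun y hy => hL y (List.mem_cons_of_mem x hy)) fun j hj => h (j + 1) (Nat.succ_lt_succ hj)
    refine (runs_loop_cons (hS 0 (Nat.zero_le _)) (hL x List.mem_cons_self)
      (h 0 (Nat.succ_pos _)) tail).mono (le_of_eq ?_)
    rw [List.length_cons]
    ring

/-- A statement of the subroutine as a statement of a program. -/
def liftStmt : Stmt M.Γ M.Λ M.σ → Stmt (stackAlphabet K M) M.Λ (Option Bool × M.σ)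
  | .push k f q => .push (.inr k) (fun v => f v.2) (liftStmt q)
  | .peek k f q => .peek (.inr k) (fun v o => (v.1, f v.2 o)) (liftStmt q)
  | .pop k f q => .pop (.inr k) (fun v o => (v.1, f v.2 o)) (liftStmt q)
  | .load f q => .load (fun v => (v.1, f v.2)) (liftStmt q)
  | .branch f q q' => .branch (fun v => f v.2) (liftStmt q) (liftStmt q')
  | .goto f => .goto fun v => f v.2
  | .halt => .halt

/-- The effect of `liftStmt` on configurations. -/
def liftCfg (b : Option Bool) (T : K → List Bool) (c : Cfg M.Γ M.Λ M.σ) :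
    Cfg (stackAlphabet K M) M.Λ (Option Bool × M.σ) :=
  ⟨c.l, (b, c.var), joinStacks T c.stk⟩

theorem stepAux_liftStmt (b : Option Bool) (T : K → List Bool) (q : Stmt M.Γ M.Λ M.σ) (v : M.σ)
    (U : ∀ k, List (M.Γ k)) :
    stepAux (liftStmt q) (b, v) (joinStacks T U) = liftCfg b T (stepAux q v U) := by
  induction q generalizing v U with
  | branch f q q' ih ih' => cases h : f v <;> simp [liftStmt, h, ih, ih']
  | goto f => rfl
  | halt => rfl
  | _ => simp [liftStmt, *]

variable (K M) in
/-- The subroutine as a program. -/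
def machine : Program K M :=
  letI := M.ΛFin
  { Λ := M.Λ, main := M.main, code := fun l => liftStmt (M.m l) }

theorem initList_eq (s : List (M.Γ M.k₀)) :
    initList M s = ⟨some M.main, M.initialState, update (emptyStacks M) M.k₀ s⟩ := by
  unfold initList
  congr 1
  funext k
  obtain rfl | h := eq_or_ne k M.k₀ <;> simp [emptyStacks, *]

theorem haltList_eq (s : List (M.Γ M.k₁)) :
    haltList M s = ⟨none, M.initialState, update (emptyStacks M) M.k₁ s⟩ := by
  unfold haltList
  congr 1
  funext k
  obtain rfl | h := eq_or_ne k M.k₁ <;> simp [emptyStacks, *]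

theorem executes_machine {s : List (M.Γ M.k₀)} {s' : List (M.Γ M.k₁)}
    (h : TM2OutputsInTime M s (some s') n) (b : Option Bool) (T : K → List Bool) :
    (machine K M).Executes (b, M.initialState) (joinStacks T (update (emptyStacks M) M.k₀ s))
      (b, M.initialState) (joinStacks T (update (emptyStacks M) M.k₁ s')) n := by
  have reaches : Reaches M.m (initList M s) (haltList M s') n := ⟨h⟩
  rw [initList_eq, haltList_eq] at reaches
  exact reaches.map (liftCfg b T) fun l v S => congrArg some (stepAux_liftStmt b T _ v S)

/-- Move the register `k` to `k'`, in reverse order. -/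
def move (k k' : K) : Program K M := Fragment.transfer (.inl k) (.inl k') id id

theorem runs_move {k k' : K} (hk : k ≠ k') (T : K → List Bool) :
    Runs (M := M) (move k k') T (update (update T k []) k' ((T k).reverse ++ T k'))
      ((T k).length + 1) := fun b =>
  ⟨none, by
    simpa [move] using Fragment.executes_transfer (Γ := stackAlphabet K M) (k := .inl k)
      (k' := .inl k') (by simpa using hk) id id b M.initialState (joinStacks T (emptyStacks M))⟩

/-- Move the register `k` to the stack `k'` of the subroutine, in reverse order. -/
def load (k : K) (k' : M.K) (write : Bool → M.Γ k') : Program K M :=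
  Fragment.transfer (.inl k) (.inr k') id write

theorem executes_load (k : K) (k' : M.K) (write : Bool → M.Γ k') (b : Option Bool)
    (T : K → List Bool) :
    (load k k' write).Executes (b, M.initialState) (joinStacks T (emptyStacks M))
      (none, M.initialState)
      (joinStacks (update T k []) (update (emptyStacks M) k' ((T k).reverse.map write)))
      ((T k).length + 1) := by
  simpa [load, emptyStacks] using Fragment.executes_transfer (Γ := stackAlphabet K M) (k := .inl k)
    (k' := .inr k') (by simp) id write b M.initialState (joinStacks T (emptyStacks M))

/-- Move the stack `k` of the subroutine to the register `k'`, in reverse order. -/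
def unload (k : M.K) (k' : K) (read : M.Γ k → Bool) : Program K M :=
  Fragment.transfer (.inr k) (.inl k') read id

theorem executes_unload (k : M.K) (k' : K) (read : M.Γ k → Bool) (b : Option Bool)
    (T : K → List Bool) (s : List (M.Γ k)) :
    (unload k k' read).Executes (b, M.initialState) (joinStacks T (update (emptyStacks M) k s))
      (none, M.initialState)
      (joinStacks (update T k' (s.reverse.map read ++ T k')) (emptyStacks M)) (s.length + 1) := by
  have empty : update (emptyStacks M) k [] = emptyStacks M := update_eq_self k _
  simpa [unload, empty] using Fragment.executes_transfer (Γ := stackAlphabet K M) (k := .inr k)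
    (k' := .inl k') (by simp) read id b M.initialState
    (joinStacks T (update (emptyStacks M) k s))

/-- Run the subroutine on the word in the register `k` and write its output to the register `k'`,
which has to be empty. -/
def call (e₀ : M.Γ M.k₀ ≃ Bool) (e₁ : M.Γ M.k₁ ≃ Bool) (k k' : K) : Program K M :=
  (move k k').seq <| (load k' M.k₀ e₀.symm).seq <| (machine K M).seq <|
    (unload M.k₁ k e₁).seq (move k k')

theorem runs_call {e₀ : M.Γ M.k₀ ≃ Bool} {e₁ : M.Γ M.k₁ ≃ Bool} {k k' : K} (hk : k ≠ k')
    (hT : T k' = []) {u : List Bool}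
    (h : TM2OutputsInTime M ((T k).map e₀.symm) (some (u.map e₁.symm)) n) :
    Runs (call e₀ e₁ k k') T (update (update T k []) k' u)
      (2 * (T k).length + 2 * u.length + n + 4) := by
  intro b
  obtain ⟨b', before⟩ := runs_move (M := M) hk T b
  have loaded := executes_load k' M.k₀ e₀.symm b' (update (update T k []) k' (T k).reverse)
  have computed := executes_machine h none (update T k [])
  have unloaded := executes_unload M.k₁ k e₁ none (update T k []) (u.map e₁.symm)
  obtain ⟨b'', after⟩ := runs_move (M := M) hk (update T k u.reverse) none
  have cleared : update (update T k []) k' [] = update T k [] := by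
    rw [update_comm hk, ← hT, update_eq_self]
  rw [hT, List.append_nil] at before
  rw [update_idem, cleared, update_self, List.reverse_reverse] at loaded
  rw [update_idem, update_self, List.append_nil, ← List.map_reverse, List.map_map,
    e₁.self_comp_symm, List.map_id] at unloaded
  rw [update_idem, update_self, update_of_ne hk.symm, hT, List.reverse_reverse,
    List.append_nil] at after
  refine ⟨b'', (before.seq <| loaded.seq <| computed.seq <| unloaded.seq after).mono ?_⟩
  simp only [List.length_reverse, List.length_map]
  omega

end Programs

section Machine

variable {K : Type} [DecidableEq K] {M : FinTM2}

/-- Forget the symbol read last. -/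
def reset : Program K M := Fragment.single (.load (fun v => (none, v.2)) .halt)

/-- The machine that runs `A` on a word in the register `i` and outputs the register `o`. -/
abbrev toFinTM2 [Fintype K] (A : Program K M) (i o : K) : FinTM2 :=
  haveI := M.kFin
  haveI := M.σFin
  letI := M.decidableEqK
  { K := K ⊕ M.K
    k₀ := .inl i
    k₁ := .inl o
    Γ := stackAlphabet K M
    Λ := (A.seq reset).Λ
    main := (A.seq reset).main
    σ := Option Bool × M.σ
    initialState := (none, M.initialState)
    Γk₀Fin := inferInstanceAs (Fintype Bool)
    m := (A.seq reset).code }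

theorem update_emptyStacks_toFinTM2 [Fintype K] (A : Program K M) (i o k : K) (x : List Bool) :
    update (emptyStacks (toFinTM2 A i o)) (.inl k) x =
      joinStacks (update (fun _ => []) k x) (emptyStacks M) := by
  rw [← update_joinStacks_inl]
  congr 1
  funext j
  rcases j with j | j <;> rfl

theorem outputs_toFinTM2 [Fintype K] {A : Program K M} {i o : K} {x y : List Bool} {n : ℕ}
    (h : Runs A (update (fun _ => []) i x) (update (fun _ => []) o y) n) :
    Nonempty (TM2OutputsInTime (toFinTM2 A i o) x (some y) (n + 1)) := by
  obtain ⟨b', run⟩ := h none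
  have steps := run.seq (B := reset) (Fragment.executes_single rfl)
  rw [← update_emptyStacks_toFinTM2 A i o, ← update_emptyStacks_toFinTM2 A i o] at steps
  have reaches : Reaches (toFinTM2 A i o).m (initList (toFinTM2 A i o) x)
      (haltList (toFinTM2 A i o) y) (n + 1) := by
    rw [initList_eq, haltList_eq]
    exact steps
  exact reaches

end Machine

section PolyBounded

variable {ι : Type*} {size : ι → ℕ} {f g : ι → ℕ}

/-- `f` is at most polynomial in the size. -/
def PolyBounded (size f : ι → ℕ) : Prop := ∃ p : Polynomial ℕ, ∀ i, f i ≤ p.eval (size i)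

theorem polyBounded_const (n : ℕ) : PolyBounded size fun _ => n :=
  ⟨.C n, fun _ => by rw [Polynomial.eval_C]⟩

theorem polyBounded_size : PolyBounded size size := ⟨.X, fun _ => by rw [Polynomial.eval_X]⟩

theorem PolyBounded.mono (hg : PolyBounded size g) (h : ∀ i, f i ≤ g i) : PolyBounded size f :=
  hg.imp fun _ hp i => (h i).trans (hp i)

theorem PolyBounded.comp {κ : Type*} (hf : PolyBounded size f) (g : κ → ι) :
    PolyBounded (fun j => size (g j)) fun j => f (g j) :=
  hf.imp fun _ hp j => hp (g j)

theorem PolyBounded.add (hf : PolyBounded size f) (hg : PolyBounded size g) :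
    PolyBounded size fun i => f i + g i :=
  let ⟨p, hp⟩ := hf
  let ⟨q, hq⟩ := hg
  ⟨p + q, fun i => by rw [Polynomial.eval_add]; exact add_le_add (hp i) (hq i)⟩

theorem PolyBounded.mul (hf : PolyBounded size f) (hg : PolyBounded size g) :
    PolyBounded size fun i => f i * g i :=
  let ⟨p, hp⟩ := hf
  let ⟨q, hq⟩ := hg
  ⟨p * q, fun i => by rw [Polynomial.eval_mul]; exact Nat.mul_le_mul (hp i) (hq i)⟩

theorem polynomial_eval_mono (p : Polynomial ℕ) : Monotone fun n => p.eval n := fun m n h => by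
  simp only [Polynomial.eval_eq_sum_range]
  gcongr

theorem PolyBounded.eval (hf : PolyBounded size f) (p : Polynomial ℕ) :
    PolyBounded size fun i => p.eval (f i) :=
  let ⟨q, hq⟩ := hf
  ⟨p.comp q, fun i => by rw [Polynomial.eval_comp]; exact polynomial_eval_mono p (hq i)⟩

end PolyBounded

section PolyRuns

variable {ι κ : Type*} {size : ι → ℕ} {K : Type} [DecidableEq K] {M : FinTM2}
  {A B : Program K M} {T T' T'' : ι → K → List Bool}

/-- For every index `i`, the program transforms the registers from `T i` to `T' i`, within a number
of steps that is polynomial in the size of `i`. -/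
def PolyRuns (size : ι → ℕ) (A : Program K M) (T T' : ι → K → List Bool) : Prop :=
  ∃ p : Polynomial ℕ, ∀ i, Runs A (T i) (T' i) (p.eval (size i))

theorem polyRuns_of_runs {n : ι → ℕ} (hn : PolyBounded size n)
    (h : ∀ i, Runs A (T i) (T' i) (n i)) : PolyRuns size A T T' :=
  hn.imp fun _ hp i => (h i).mono (hp i)

theorem PolyRuns.seq (hA : PolyRuns size A T T') (hB : PolyRuns size B T' T'') :
    PolyRuns size (A.seq B) T T'' :=
  let ⟨p, hp⟩ := hA
  let ⟨q, hq⟩ := hB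
  ⟨p + q, fun i => by rw [Polynomial.eval_add]; exact (hp i).seq (hq i)⟩

theorem PolyRuns.comp (h : PolyRuns size A T T') (g : κ → ι) :
    PolyRuns (fun j => size (g j)) A (fun j => T (g j)) fun j => T' (g j) :=
  h.imp fun _ hp j => hp (g j)

theorem PolyRuns.congr {U U' : ι → K → List Bool} (h : PolyRuns size A T T')
    (hT : ∀ i, T i = U i) (hT' : ∀ i, T' i = U' i) : PolyRuns size A U U' :=
  funext hT ▸ funext hT' ▸ h

theorem polyRuns_skip : PolyRuns (M := M) size skip T T :=
  polyRuns_of_runs (polyBounded_const 1) fun i => runs_skip (T i)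

theorem polyRuns_push (k : K) (x : Bool) :
    PolyRuns (M := M) size (push k x) T fun i => update (T i) k (x :: T i k) :=
  polyRuns_of_runs (polyBounded_const 1) fun i => runs_push k x (T i)

theorem polyRuns_move {k k' : K} (hk : k ≠ k') (hT : PolyBounded size fun i => (T i k).length) :
    PolyRuns (M := M) size (move k k') T
      fun i => update (update (T i) k []) k' ((T i k).reverse ++ T i k') :=
  polyRuns_of_runs (hT.add (polyBounded_const 1)) fun i => runs_move hk (T i)

theorem PolyRuns.popCase {k : K} {A : Option Bool → Program K M}
    (h : ∀ o, PolyRuns (fun i : {i // (T i k).head? = o} => size i) (A o)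
      (fun i => update (T i) k (T i k).tail) fun i => T' i) :
    PolyRuns size (popCase k A) T T' := by
  choose p hp using h
  refine ⟨∑ o, p o + 1, fun i => (runs_popCase (hp _ ⟨i, rfl⟩)).mono ?_⟩
  rw [Polynomial.eval_add, Polynomial.eval_finsetSum, Polynomial.eval_one]
  exact Nat.succ_le_succ <|
    Finset.single_le_sum (f := fun o => (p o).eval (size i)) (fun _ _ => Nat.zero_le _)
      (Finset.mem_univ _)

theorem PolyRuns.loop {k : K} {mark : Option Bool} {A : Bool → Program K M}
    {S : ι → ℕ → K → List Bool} {L rest : ι → List Bool}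
    (hbound : PolyBounded size fun i => (L i).length)
    (hS : ∀ i, ∀ j ≤ (L i).length, S i j k = (L i).drop j ++ rest i)
    (hL : ∀ i, ∀ x ∈ L i, some x ≠ mark) (hrest : ∀ i, (rest i).head? = mark)
    (h : ∀ x, PolyRuns (fun p : {p : ι × ℕ // (L p.1)[p.2]? = some x} => size p.1.1) (A x)
      (fun p => update (S p.1.1 p.1.2) k ((L p.1.1).drop (p.1.2 + 1) ++ rest p.1.1))
      fun p => S p.1.1 (p.1.2 + 1)) :
    PolyRuns size (loop k mark A) (fun i => S i 0)
      fun i => update (S i (L i).length) k (rest i).tail := by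
  choose p hp using h
  have cost : PolyBounded size fun i => (∑ x, p x).eval (size i) := polyBounded_size.eval _
  refine polyRuns_of_runs
    ((hbound.mul (cost.add (polyBounded_const 1))).add (polyBounded_const 1)) fun i =>
    runs_loop (hS i) (hL i) (hrest i) fun j hj =>
      (hp _ ⟨(i, j), List.getElem?_eq_getElem hj⟩).mono ?_
  rw [Polynomial.eval_finsetSum]
  exact Finset.single_le_sum (f := fun x => (p x).eval (size i)) (fun _ _ => Nat.zero_le _)
    (Finset.mem_univ _)

/-- Empty the register `k`, executing `A x` after each popped symbol `x`. -/
def drain (k : K) (A : Bool → Program K M) : Program K M := loop k none A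

theorem PolyRuns.drain {k : K} {A : Bool → Program K M} {S : ι → ℕ → K → List Bool}
    {L : ι → List Bool} (hbound : PolyBounded size fun i => (L i).length)
    (hS : ∀ i, ∀ j ≤ (L i).length, S i j k = (L i).drop j)
    (h : ∀ x, PolyRuns (fun p : {p : ι × ℕ // (L p.1)[p.2]? = some x} => size p.1.1) (A x)
      (fun p => update (S p.1.1 p.1.2) k ((L p.1.1).drop (p.1.2 + 1)))
      fun p => S p.1.1 (p.1.2 + 1)) :
    PolyRuns size (drain k A) (fun i => S i 0) fun i => S i (L i).length := by
  refine (PolyRuns.loop (rest := fun _ => []) hbound (by simpa using hS) (by simp)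
    (fun _ => rfl) (by simpa using h)).congr (fun _ => rfl) fun i => ?_
  simp [hS, update_eq_self_iff]

/-- Empty the register `k`. -/
def clear (k : K) : Program K M := drain k fun _ => skip

theorem polyRuns_clear {k : K} (hT : PolyBounded size fun i => (T i k).length) :
    PolyRuns (M := M) size (clear k) T fun i => update (T i) k [] :=
  (PolyRuns.drain (S := fun i j => update (T i) k ((T i k).drop j)) hT (by simp)
    fun _ => polyRuns_skip.congr (fun _ => (update_idem _ _ _).symm) fun _ => rfl).congr
      (by simp) (by simp)

theorem unaryEncodeNat_eq_replicate (n : ℕ) : unaryEncodeNat n = List.replicate n true := by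
  induction n with
  | zero => rfl
  | succ n ih => rw [unaryEncodeNat, ih, List.replicate_succ]

/-- Move the unary number in front of the register `k`, without its end marker, to `k'`. -/
def readField (k k' : K) : Program K M := loop k (some false) fun _ => push k' true

theorem polyRuns_readField {k k' : K} (hk : k ≠ k') {n : ι → ℕ} {rest : ι → List Bool}
    (hn : PolyBounded size n) (hT : ∀ i, T i k = encodeField (n i) ++ rest i)
    (hT' : ∀ i, T i k' = []) :
    PolyRuns (M := M) size (readField k k') T
      fun i => update (update (T i) k (rest i)) k' (List.replicate (n i) true) := by
  simp only [encodeField, unaryEncodeNat_eq_replicate] at hT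
  refine (PolyRuns.loop (L := fun i => List.replicate (n i) true) (rest := fun i => false :: rest i)
    (S := fun i j => update (update (T i) k (List.replicate (n i - j) true ++ false :: rest i)) k'
      (List.replicate j true)) ?_ ?_ ?_ ?_ ?_).congr ?_ ?_
  · simpa using hn
  · simp [hk]
  · simp
  · simp
  · exact fun x => (polyRuns_push k' true).congr (fun _ => rfl) (by grind [update_apply])
  · grind [update_apply]
  · grind [update_apply]

theorem polyRuns_call {α β : Type} {ea : α → List Bool} {eb : β → List Bool} {f : α → β}
    (h : TM2ComputableInPolyTime ea eb f) {k k' : K} (hk : k ≠ k') {a : ι → α}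
    (hT : ∀ i, T i k = ea (a i)) (hT' : ∀ i, T i k' = [])
    (ha : PolyBounded size fun i => (ea (a i)).length)
    (hf : PolyBounded size fun i => (eb (f (a i))).length) :
    PolyRuns (M := h.tm) size (call h.inputAlphabet h.outputAlphabet k k') T
      fun i => update (update (T i) k []) k' (eb (f (a i))) := by
  refine polyRuns_of_runs (((((polyBounded_const 2).mul ha).add ((polyBounded_const 2).mul hf)).add
    (ha.eval h.time)).add (polyBounded_const 4)) fun i => ?_
  rw [← hT]
  refine runs_call hk (hT' i) ?_
  rw [hT]
  exact h.outputsFun (a i)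

theorem polyTimeSolvable_of_polyRuns [Finite K] {α : Type} {enc : α → List Bool} {p : α → Prop}
    [DecidablePred p] {i o : K} (h : PolyRuns (fun a => (enc a).length) A
      (fun a => update (fun _ => []) i (enc a)) fun a => update (fun _ => []) o [decide (p a)]) :
    PolyTimeSolvable enc p := by
  have := Fintype.ofFinite K
  obtain ⟨time, h⟩ := h
  refine ⟨⟨⟨toFinTM2 A i o, Equiv.refl Bool, Equiv.refl Bool⟩, time + 1, fun a => ?_⟩⟩
  rw [Polynomial.eval_add, Polynomial.eval_one]
  have output := Classical.choice (outputs_toFinTM2 (h a))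
  convert output using 1
  · exact List.map_id _
  · simp [encodeBool]

/-- Execute the programs `f k` for all entries `k` of the list, from the last to the first. -/
def forAll {κ : Type*} (f : κ → Program K M) : List κ → Program K M
  | [] => skip
  | k :: ks => (forAll f ks).seq (f k)

theorem PolyRuns.forAll {f : κ → Program K M} {S : List κ → ι → K → List Bool}
    (h : ∀ k ks, PolyRuns size (f k) (S ks) (S (k :: ks))) :
    ∀ ks, PolyRuns size (forAll f ks) (S []) (S ks)
  | [] => polyRuns_skip
  | k :: ks => (PolyRuns.forAll h ks).seq (h k ks)

theorem polyRuns_forAll_clear (hT : ∀ k, PolyBounded size fun i => (T i k).length) (ks : List K) :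
    PolyRuns (M := M) size (forAll clear ks) T fun i r => if r ∈ ks then [] else T i r :=
  (PolyRuns.forAll (S := fun ks i r => if r ∈ ks then [] else T i r) (fun k _ =>
    (polyRuns_clear ((hT k).mono fun i => by grind)).congr (fun _ => rfl) (by grind [update_apply]))
    ks).congr (by simp) fun _ => rfl

/-- Write the word `w` in front of the register `k`. -/
def pushWord (k : K) (w : List Bool) : Program K M := forAll (push k) w

theorem polyRuns_pushWord (k : K) (w : List Bool) :
    PolyRuns (M := M) size (pushWord k w) T fun i => update (T i) k (w ++ T i k) :=
  (PolyRuns.forAll (S := fun w i => update (T i) k (w ++ T i k))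
    (fun x w => (polyRuns_push k x).congr (fun _ => rfl) (by simp)) w).congr (by simp) fun _ => rfl

end PolyRuns

section Prepends

variable {ι κ : Type*} {size : ι → ℕ} {K : Type} [DecidableEq K] {M : FinTM2}
  {A B : Program K M} {r : K} {T : ι → K → List Bool} {e e' : ι → List Bool}

/-- The program writes the words `e i`, of polynomial length, in front of the register `r`, in
polynomial time; all registers but `r` have to be as in `T i` and are restored. -/
structure Prepends (size : ι → ℕ) (A : Program K M) (r : K) (T : ι → K → List Bool)
    (e : ι → List Bool) : Prop where
  bounded : PolyBounded size fun i => (e i).length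
  runs : PolyRuns (fun p : ι × List Bool => size p.1) A (fun p => update (T p.1) r p.2)
    fun p => update (T p.1) r (e p.1 ++ p.2)

theorem Prepends.seq (hA : Prepends size A r T e) (hB : Prepends size B r T e') :
    Prepends size (A.seq B) r T fun i => e' i ++ e i where
  bounded := (hB.bounded.add hA.bounded).mono fun _ => List.length_append.le
  runs := (hA.runs.seq
    (hB.runs.comp fun p : ι × List Bool => (p.1, e p.1 ++ p.2))).congr (fun _ => rfl)
    fun _ => by rw [List.append_assoc]

theorem Prepends.polyRuns (h : Prepends size A r T e) (hT : ∀ i, T i r = []) :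
    PolyRuns size A T fun i => update (T i) r (e i) :=
  (h.runs.comp fun i => (i, [])).congr (by simpa) (by simp)

theorem prepends_skip : Prepends (M := M) size skip r T fun _ => [] where
  bounded := polyBounded_const 0
  runs := polyRuns_skip

theorem prepends_pushWord (w : List Bool) :
    Prepends (M := M) size (pushWord r w) r T fun _ => w where
  bounded := polyBounded_const _
  runs := (polyRuns_pushWord r w).congr (fun _ => rfl) (by simp)

theorem Prepends.forAll {f : κ → Program K M} {e : κ → ι → List Bool}
    (h : ∀ k, Prepends size (f k) r T (e k)) :
    ∀ ks : List κ, Prepends size (forAll f ks) r T fun i => ks.flatMap fun k => e k i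
  | [] => prepends_skip
  | k :: ks => (Prepends.forAll h ks).seq (h k)

/-- Write the image of the word in the register `k` under `f` in front of the register `r`, using
the empty register `aux`. -/
def translate (aux k r : K) (f : Bool → List Bool) : Program K M :=
  (move k aux).seq <| drain aux fun x => (push k x).seq (pushWord r (f x))

theorem prepends_translate {aux k : K} (hk : k ≠ aux) (hr : r ≠ aux) (hkr : k ≠ r)
    (f : Bool → List Bool) (haux : ∀ i, T i aux = [])
    (hT : PolyBounded size fun i => (T i k).length) :
    Prepends (M := M) size (translate aux k r f) r T fun i => (T i k).flatMap f where
  bounded := by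
    refine (hT.mul (polyBounded_const (∑ x, (f x).length))).mono fun i => ?_
    rw [List.length_flatMap, ← List.length_map fun x => (f x).length]
    refine List.sum_le_card_nsmul _ _ fun n hn => ?_
    obtain ⟨x, -, rfl⟩ := List.mem_map.1 hn
    exact Finset.single_le_sum (f := fun x => (f x).length) (fun _ _ => Nat.zero_le _)
      (Finset.mem_univ x)
  runs := by
    let L (p : ι × List Bool) : List Bool := (T p.1 k).reverse
    let S (p : ι × List Bool) (j : ℕ) : K → List Bool :=
      update (update (update (T p.1) k ((L p).take j).reverse) aux ((L p).drop j)) r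
        (((L p).take j).reverse.flatMap f ++ p.2)
    have hL : PolyBounded (fun p : ι × List Bool => size p.1) fun p => (L p).length :=
      hT.imp fun _ hp p => by simpa only [L, List.length_reverse] using hp p.1
    have moved : PolyRuns (M := M) (fun p : ι × List Bool => size p.1) (move k aux)
        (fun p => update (T p.1) r p.2) fun p => S p 0 :=
      (polyRuns_move hk (by simpa [L, hkr] using hL)).congr (fun _ => rfl) fun p => by
        simp only [S, List.take_zero, List.drop_zero, List.reverse_nil, List.flatMap_nil]
        grind [update_apply]
    have drained := PolyRuns.drain (M := M) (A := fun x => (push k x).seq (pushWord r (f x)))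
      (k := aux) (S := S) hL (by simp [S, hr.symm]) fun x =>
        ((polyRuns_push k x).seq (polyRuns_pushWord r (f x))).congr (fun _ => rfl)
          fun ⟨⟨p, j⟩, hj⟩ => by simp only [S, List.take_add_one, hj]; grind [update_apply]
    exact (moved.seq drained).congr (fun _ => rfl) (by grind [update_apply])

/-- Write a copy of the register `k` in front of the register `r`, using the empty register
`aux`. -/
def copy (aux k r : K) : Program K M := translate aux k r fun x => [x]

theorem prepends_copy {aux k : K} (hk : k ≠ aux) (hr : r ≠ aux) (hkr : k ≠ r)
    (haux : ∀ i, T i aux = []) (hT : PolyBounded size fun i => (T i k).length) :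
    Prepends (M := M) size (copy aux k r) r T fun i => T i k := by
  simpa only [copy, List.flatMap_singleton'] using
    prepends_translate hk hr hkr (fun x => [x]) haux hT

theorem polyRuns_forAll_copy {aux k : K} (hk : k ≠ aux) (haux : ∀ i, T i aux = [])
    (hT : PolyBounded size fun i => (T i k).length) :
    ∀ ks : List K, (aux :: k :: ks).Nodup → (∀ i, ∀ r ∈ ks, T i r = []) →
      PolyRuns (M := M) size (forAll (copy aux k) ks) T
        fun i r => if r ∈ ks then T i k else T i r
  | [], _, _ => polyRuns_skip.congr (by simp) fun _ => rfl
  | r :: ks, hks, hempty => by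
    have ih := polyRuns_forAll_copy hk haux hT ks (by grind) (by grind)
    refine (ih.seq ((prepends_copy (r := r) hk (by grind) (by grind) (by grind) ?_).polyRuns
      (by grind))).congr (fun _ => rfl) fun i => ?_
    · exact hT.mono (by grind)
    · grind [update_apply]

end Prepends

section BranchEq

variable {ι : Type*} {size : ι → ℕ} {K : Type} [DecidableEq K] {M : FinTM2}
  {T : ι → K → List Bool} {u v : ι → ℕ} {k k' d : K}

/-- Pop the unary numbers in the registers `k` and `k'` simultaneously until `k` is empty, counting
in the register `d` how often `k'` was empty already. -/
def cancel (k k' d : K) : Program K M :=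
  drain k fun _ => popCase k' fun o => o.elim (push d true) fun _ => skip

theorem polyRuns_cancel (hkk' : k ≠ k') (hkd : k ≠ d) (hk'd : k' ≠ d)
    (hTk : ∀ i, T i k = List.replicate (u i) true)
    (hTk' : ∀ i, T i k' = List.replicate (v i) true) (hTd : ∀ i, T i d = [])
    (hu : PolyBounded size u) :
    PolyRuns (M := M) size (cancel k k' d) T fun i =>
      update (update (update (T i) k []) k' (List.replicate (v i - u i) true)) d
        (List.replicate (u i - v i) true) := by
  let state (i : ι) (a b c : ℕ) : K → List Bool :=
    update (update (update (T i) k (List.replicate a true)) k' (List.replicate b true)) d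
      (List.replicate c true)
  have state_k (i a b c) : state i a b c k = List.replicate a true := by simp [state, hkk', hkd]
  have state_k' (i a b c) : state i a b c k' = List.replicate b true := by simp [state, hk'd]
  have state_d (i a b c) : state i a b c d = List.replicate c true := by simp [state]
  have update_k (i a b c a') :
      update (state i a b c) k (List.replicate a' true) = state i a' b c := by
    grind [update_apply]
  have update_k' (i a b c b') :
      update (state i a b c) k' (List.replicate b' true) = state i a b' c := by
    grind [update_apply]
  have update_d (i a b c c') :
      update (state i a b c) d (List.replicate c' true) = state i a b c' := update_idem _ _ _
  refine (PolyRuns.drain (S := fun i j => state i (u i - j) (v i - j) (j - v i))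
    (L := fun i => List.replicate (u i) true) (by simpa using hu) (by simp [state_k])
    fun _ => .popCase fun
      | none => (polyRuns_push d true).congr (fun _ => rfl) fun ⟨⟨⟨i, j⟩, hj⟩, ho⟩ => ?_
      | some _ => polyRuns_skip.congr (fun ⟨⟨⟨i, j⟩, hj⟩, ho⟩ => ?_) fun _ => rfl).congr
    (by grind [update_apply]) fun i => ?_
  · simp [state]
  · have exhausted : v i ≤ j := by
      simpa [update_k, state_k', Nat.sub_eq_zero_iff_le] using ho
    simp [update_k, update_k', state_k', state_d, ← List.replicate_succ, update_d,
      Nat.sub_add_comm exhausted, Nat.sub_sub]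
  · have remaining : j < v i := by
      refine lt_of_not_ge fun h => ?_
      simp [update_k, state_k', Nat.sub_eq_zero_of_le h] at ho
    simp [update_k, update_k', state_k', Nat.sub_eq_zero_of_le remaining.le,
      Nat.sub_eq_zero_of_le remaining, Nat.sub_sub]

/-- Add the distance between the unary numbers in the registers `k` and `k'` to the register `d`,
and empty `k` and `k'`. -/
def distance (k k' d : K) : Program K M := (cancel k k' d).seq (move k' d)

theorem polyRuns_distance (hkk' : k ≠ k') (hkd : k ≠ d) (hk'd : k' ≠ d)
    (hTk : ∀ i, T i k = List.replicate (u i) true)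
    (hTk' : ∀ i, T i k' = List.replicate (v i) true) (hTd : ∀ i, T i d = [])
    (hu : PolyBounded size u) (hv : PolyBounded size v) :
    PolyRuns (M := M) size (distance k k' d) T fun i =>
      update (update (update (T i) k []) k' []) d (List.replicate ((u i).dist (v i)) true) := by
  refine ((polyRuns_cancel hkk' hkd hk'd hTk hTk' hTd hu).seq
    (polyRuns_move hk'd (hv.mono fun i => ?_))).congr (fun _ => rfl) fun i => ?_
  · simp [hk'd]
  · rw [update_of_ne hk'd, update_self, update_self, List.reverse_replicate,
      List.replicate_append_replicate, Nat.add_comm, ← Nat.dist]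
    grind [update_apply]

/-- Continue with `A` if the unary numbers in the registers `k` and `k'` are equal and with `B`
otherwise, using the empty register `d`; `k` and `k'` are emptied. -/
def branchEq (k k' d : K) (A B : Program K M) : Program K M :=
  (distance k k' d).seq <| popCase d fun o => o.elim A fun _ => (clear d).seq B

theorem PolyRuns.branchEq {A B : Program K M} {T' : ι → K → List Bool}
    (hkk' : k ≠ k') (hkd : k ≠ d) (hk'd : k' ≠ d)
    (hTk : ∀ i, T i k = List.replicate (u i) true)
    (hTk' : ∀ i, T i k' = List.replicate (v i) true) (hTd : ∀ i, T i d = [])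
    (hu : PolyBounded size u) (hv : PolyBounded size v)
    (hA : PolyRuns (fun i : {i // u i = v i} => size i) A
      (fun i => update (update (T i) k []) k' []) fun i => T' i)
    (hB : PolyRuns (fun i : {i // u i ≠ v i} => size i) B
      (fun i => update (update (T i) k []) k' []) fun i => T' i) :
    PolyRuns size (branchEq k k' d A B) T T' := by
  refine (polyRuns_distance hkk' hkd hk'd hTk hTk' hTd hu hv).seq (.popCase fun o => ?_)
  cases o with
  | none =>
    refine (hA.comp (Subtype.map id fun i hi => ?_)).congr (fun ⟨i, hi⟩ => ?_) fun _ => rfl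
    · exact Nat.eq_of_dist_eq_zero (by simpa using hi)
    · simp only [Subtype.map_coe, id]
      grind [update_apply]
  | some x =>
    have dist_le : PolyBounded size fun i => (u i).dist (v i) :=
      (hu.add hv).mono fun i => by rw [Nat.dist]; omega
    refine (polyRuns_clear ((dist_le.comp Subtype.val).mono fun i => ?_)).seq
      ((hB.comp (Subtype.map id fun i hi (h : u i = v i) => ?_)).congr (fun _ => ?_) fun _ => rfl)
    · simp
    · simp [h] at hi
    · simp only [update_self, update_idem, Subtype.map_coe, id]
      grind [update_apply]

end BranchEq

/-- The registers of a program that searches for a vector of natural numbers indexed by `κ`: the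
input word; the unary numbers `bound`, which bounds the entries of the vector, and `target`, both
read off the input; the word passed to the subroutine; scratch registers; the answer; and, in
unary, the current vector and the difference of its entries to `bound`. -/
inductive Reg (κ : Type)
  | input | bound | target | query | aux | left | right | diff | answer
  | value (k : κ)
  | remaining (k : κ)
  deriving DecidableEq, Fintype

/-- The input of a search: the bound for the entries of the vector, a target number, and a word
that specifies the rest of the problem. -/
structure SearchInput where
  bound : ℕ
  target : ℕ
  word : List Bool

namespace SearchInput

/-- A search input is written with the two numbers in unary, in front of the word. -/
def encode (x : SearchInput) : List Bool := encodeField x.bound ++ encodeField x.target ++ x.word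

/-- The length of the encoding. -/
def size (x : SearchInput) : ℕ := x.encode.length

theorem size_eq (x : SearchInput) : x.size = x.bound + 1 + (x.target + 1) + x.word.length := by
  simp [size, encode, encodeField, unaryEncodeNat_eq_replicate]
  omega

end SearchInput

section Search

variable {κ : Type}

open scoped Classical in
/-- The registers while the vector `c` is being tested, where `found` says whether one of the
vectors before passed the test. -/
noncomputable def searchState (x : SearchInput) (found : Prop) (c : κ → ℕ) : Reg κ → List Bool
  | .input => x.word
  | .bound => List.replicate x.bound true
  | .target => List.replicate x.target true
  | .answer => [decide found]
  | .value k => List.replicate (c k) true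
  | .remaining k => List.replicate (x.bound - c k) true
  | _ => []

theorem polyBounded_bound {ι : Type*} (x : ι → SearchInput) :
    PolyBounded (fun i => (x i).size) fun i => (x i).bound :=
  polyBounded_size.mono fun i => by have := (x i).size_eq; omega

theorem polyBounded_target {ι : Type*} (x : ι → SearchInput) :
    PolyBounded (fun i => (x i).size) fun i => (x i).target :=
  polyBounded_size.mono fun i => by have := (x i).size_eq; omega

theorem length_searchState_le {x : SearchInput} {c : κ → ℕ} (hc : ∀ k, c k ≤ x.bound)
    (found : Prop) (r : Reg κ) : (searchState x found c r).length ≤ x.size := by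
  have := x.size_eq
  cases r with
  | value k =>
    have := hc k
    simp only [searchState, List.length_replicate]
    omega
  | _ =>
    simp only [searchState, List.length_replicate, List.length_singleton, List.length_nil]
    omega

theorem polyBounded_searchState {ι : Type*} {x : ι → SearchInput} {c : ι → κ → ℕ}
    (hc : ∀ i k, c i k ≤ (x i).bound) (r : Reg κ) :
    PolyBounded (fun p : ι × Prop => (x p.1).size)
      fun p => (searchState (x p.1) p.2 (c p.1) r).length :=
  polyBounded_size.mono fun p => length_searchState_le (hc p.1) p.2 r

variable [DecidableEq κ] {ι : Type*} {M : FinTM2} {A B L : Program (Reg κ) M}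
  {x : ι → SearchInput} {c : ι → κ → ℕ} {R : ι → Prop}

/-- In time polynomial in the size of the search input, the program records in the answer whether
the vector `c i` has the property `R i`. -/
def Tests (A : Program (Reg κ) M) (x : ι → SearchInput) (c : ι → κ → ℕ) (R : ι → Prop) : Prop :=
  PolyRuns (fun p : ι × Prop => (x p.1).size) A (fun p => searchState (x p.1) p.2 (c p.1))
    fun p => searchState (x p.1) (p.2 ∨ R p.1) (c p.1)

theorem Tests.comp (hA : Tests A x c R) {ι' : Type*} (g : ι' → ι) :
    Tests A (fun i => x (g i)) (fun i => c (g i)) fun i => R (g i) :=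
  PolyRuns.comp hA (Prod.map g id)

theorem Tests.congr {R' : ι → Prop} (hA : Tests A x c R) (h : ∀ i, R i ↔ R' i) :
    Tests A x c R' :=
  funext (fun i => propext (h i)) ▸ hA

theorem tests_skip (h : ∀ i, ¬ R i) : Tests (M := M) skip x c R :=
  polyRuns_skip.congr (fun p => by simp only [h, or_false]) fun _ => rfl

/-- Change the answer to yes. -/
def accept : Program (Reg κ) M := (clear .answer).seq (push .answer true)

theorem tests_accept (h : ∀ i, R i) : Tests (M := M) accept x c R := by
  refine ((polyRuns_clear (k := Reg.answer) ((polyBounded_const 1).mono fun _ => le_rfl)).seq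
    (polyRuns_push Reg.answer true)).congr (fun _ => rfl) fun p => ?_
  rw [update_self, update_idem]
  funext r
  cases r <;> simp [searchState, h]

/-- After computing a number in the register `left` by `L`, continue with `A` if it equals the
number in the register `r`, and with `B` otherwise. -/
def ifEq (L : Program (Reg κ) M) (r : Reg κ) (A B : Program (Reg κ) M) : Program (Reg κ) M :=
  L.seq ((copy .aux r .right).seq (branchEq .left .right .diff A B))

theorem Tests.ifEq {u v : ι → ℕ} {r : Reg κ}
    (hr : r ∉ ({.aux, .left, .right} : Finset (Reg κ)))
    (hL : PolyRuns (fun p : ι × Prop => (x p.1).size) L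
      (fun p => searchState (x p.1) p.2 (c p.1))
      fun p => update (searchState (x p.1) p.2 (c p.1)) .left (List.replicate (u p.1) true))
    (hv : ∀ p : ι × Prop, searchState (x p.1) p.2 (c p.1) r = List.replicate (v p.1) true)
    (hu : PolyBounded (fun i => (x i).size) u) (hv' : PolyBounded (fun i => (x i).size) v)
    (hA : Tests A (fun i : {i // u i = v i} => x i) (fun i => c i) fun i => R i)
    (hB : Tests B (fun i : {i // u i ≠ v i} => x i) (fun i => c i) fun i => R i) :
    Tests (ifEq L r A B) x c R := by
  simp only [Finset.mem_insert, Finset.mem_singleton, not_or] at hr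
  obtain ⟨haux, hleft, hright⟩ := hr
  replace hu := hu.comp (Prod.fst : ι × Prop → ι)
  replace hv' := hv'.comp (Prod.fst : ι × Prop → ι)
  have cleared (p : ι × Prop) (a b : List Bool) :
      searchState (x p.1) p.2 (c p.1) = update (update (update (update
        (searchState (x p.1) p.2 (c p.1)) .left a) .right b) .left []) .right [] := by
    have : searchState (x p.1) p.2 (c p.1) .left = [] := rfl
    have : searchState (x p.1) p.2 (c p.1) .right = [] := rfl
    grind [update_apply]
  refine hL.seq (((prepends_copy haux (by simp) hright (fun _ => rfl) ?_).polyRuns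
    fun _ => rfl).seq (.branchEq (u := fun p => u p.1) (v := fun p => v p.1) (by simp) (by simp)
      (by simp) (by simp) (by simp [hv, hleft]) (fun _ => rfl) hu hv' ?_ ?_))
  · simpa [hv, hleft] using hv'
  · exact (PolyRuns.comp hA fun p : {p : ι × Prop // u p.1 = v p.1} => (⟨p.1.1, p.2⟩, p.1.2)).congr
      (fun p => cleared p _ _) fun _ => rfl
  · exact (PolyRuns.comp hB fun p : {p : ι × Prop // u p.1 ≠ v p.1} => (⟨p.1.1, p.2⟩, p.1.2)).congr
      (fun p => cleared p _ _) fun _ => rfl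

theorem prepends_copy_left {r : Reg κ} (hr : r ∉ ({.aux, .left} : Finset (Reg κ)))
    (hc : ∀ i k, c i k ≤ (x i).bound) :
    Prepends (M := M) (fun p : ι × Prop => (x p.1).size) (copy .aux r .left) .left
      (fun p => searchState (x p.1) p.2 (c p.1)) fun p => searchState (x p.1) p.2 (c p.1) r := by
  simp only [Finset.mem_insert, Finset.mem_singleton, not_or] at hr
  exact prepends_copy hr.1 (by simp) hr.2 (fun _ => rfl) (polyBounded_searchState hc r)

theorem flatMap_replicate_eq_replicate_sum {α β : Type*} (l : List α) (n : α → ℕ) (b : β) :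
    (l.flatMap fun a => List.replicate (n a) b) = List.replicate (l.map n).sum b := by
  induction l with
  | nil => rfl
  | cons a l ih => rw [List.flatMap_cons, ih, List.replicate_append_replicate, List.map_cons,
      List.sum_cons]

/-- Continue with `A` if the entries of the current vector sum up to `bound`. -/
noncomputable def guardSum [Fintype κ] (A : Program (Reg κ) M) : Program (Reg κ) M :=
  ifEq (forAll (fun k => copy .aux (.value k) .left) Finset.univ.toList) .bound A skip

theorem Tests.guardSum [Fintype κ] (hc : ∀ i k, c i k ≤ (x i).bound)
    (hA : Tests A (fun i : {i // ∑ k, c i k = (x i).bound} => x i) (fun i => c i) fun i => R i)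
    (hR : ∀ i, R i → ∑ k, c i k = (x i).bound) :
    Tests (guardSum A) x c R := by
  have sum : Prepends (M := M) (fun p : ι × Prop => (x p.1).size)
      (forAll (fun k => copy .aux (.value k) .left) Finset.univ.toList) .left
      (fun p => searchState (x p.1) p.2 (c p.1))
      fun p => List.replicate (∑ k, c p.1 k) true := by
    simpa only [searchState, flatMap_replicate_eq_replicate_sum, Finset.sum_map_toList] using
      Prepends.forAll (fun k => prepends_copy_left (M := M) (r := .value k) (by simp) hc)
        Finset.univ.toList
  refine .ifEq (by simp) (sum.polyRuns fun _ => rfl) (fun _ => rfl) ?_ ?_ hA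
    (tests_skip fun i hi => i.2 (hR i hi))
  · simpa using sum.bounded.comp fun i => (i, False)
  · exact polyBounded_bound x

/-- The register that holds the entry of the current vector with a given index, or the bound. -/
def operand : Option κ → Reg κ
  | none => .bound
  | some k => .value k

/-- Continue with `A` unless the entries of the current vector with indices `p.1` and `p.2` are
equal for a pair `p` in the list; the index `none` stands for the bound. -/
def guardNe : List (Option κ × Option κ) → Program (Reg κ) M → Program (Reg κ) M
  | [], A => A
  | p :: ps, A => ifEq (copy .aux (operand p.1) .left) (operand p.2) skip (guardNe ps A)

theorem Tests.guardNe {ι : Type*} {x : ι → SearchInput} {c : ι → κ → ℕ} {R : ι → Prop} :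
    ∀ {ps : List (Option κ × Option κ)}, (∀ i k, c i k ≤ (x i).bound) →
      Tests A (fun i : {i // ∀ p ∈ ps, p.1.elim (x i).bound (c i) ≠ p.2.elim (x i).bound (c i)} =>
        x i) (fun i => c i) (fun i => R i) →
      (∀ i, R i → ∀ p ∈ ps, p.1.elim (x i).bound (c i) ≠ p.2.elim (x i).bound (c i)) →
      Tests (guardNe ps A) x c R
  | [], _, hA, _ => hA.comp fun i => ⟨i, fun _ h => nomatch h⟩
  | (o, o') :: ps, hc, hA, hR => by
    have value (o : Option κ) (i : ι) (found : Prop) : searchState (x i) found (c i) (operand o) =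
        List.replicate (o.elim (x i).bound (c i)) true := by cases o <;> rfl
    have bounded (o : Option κ) :
        PolyBounded (fun i => (x i).size) fun i => o.elim (x i).bound (c i) := by
      simpa [value] using (polyBounded_searchState hc (operand o)).comp fun i => (i, False)
    let first (i : ι) : Prop := o.elim (x i).bound (c i) ≠ o'.elim (x i).bound (c i)
    have tail := Tests.guardNe (ps := ps) (ι := {i // first i}) (fun i => hc i)
      (hA.comp fun i : {i : {i // first i} // ∀ p ∈ ps,
        p.1.elim (x i).bound (c i) ≠ p.2.elim (x i).bound (c i)} =>
          ⟨i.1.1, List.forall_mem_cons.2 ⟨i.1.2, i.2⟩⟩)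
      fun i hi p hp => hR i hi p (List.mem_cons_of_mem _ hp)
    have left : operand o ∉ ({.aux, .left} : Finset (Reg κ)) := by cases o <;> simp [operand]
    have right : operand o' ∉ ({.aux, .left, .right} : Finset (Reg κ)) := by
      cases o' <;> simp [operand]
    exact .ifEq right
      (((prepends_copy_left left hc).polyRuns fun _ => rfl).congr (fun _ => rfl)
        fun p => by rw [value])
      (fun p => value o' p.1 p.2) (bounded o) (bounded o')
      (tests_skip fun i hi => hR i hi _ List.mem_cons_self i.2) tail

/-- Write a word to the register `query` by `W`, run the subroutine `h.tm` on it, and accept if the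
computed number is `target`. -/
def queryTest {α : Type} {ea : α → List Bool} {f : α → ℕ}
    (h : TM2ComputableInPolyTime ea unaryEncodeNat f) (W : Program (Reg κ) h.tm) :
    Program (Reg κ) h.tm :=
  ifEq (W.seq (call h.inputAlphabet h.outputAlphabet .query .left)) .target accept skip

theorem tests_queryTest {α : Type} {ea : α → List Bool} {f : α → ℕ}
    {h : TM2ComputableInPolyTime ea unaryEncodeNat f} {W : Program (Reg κ) h.tm} {a : ι → α}
    (hW : Prepends (fun p : ι × Prop => (x p.1).size) W .query
      (fun p => searchState (x p.1) p.2 (c p.1)) fun p => ea (a p.1))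
    (hf : PolyBounded (fun i => (x i).size) fun i => f (a i)) :
    Tests (queryTest h W) x c fun i => f (a i) = (x i).target := by
  refine .ifEq (u := fun i => f (a i)) (v := fun i => (x i).target) (by simp)
    (((hW.polyRuns fun _ => rfl).seq (polyRuns_call h (by simp) (a := fun p => a p.1) (by simp)
      (fun _ => rfl) hW.bounded ?_)).congr (fun _ => rfl) fun p => ?_) (fun _ => rfl) hf
    (polyBounded_target x) (tests_accept fun i => i.2) (tests_skip fun i => i.2)
  · simpa [unaryEncodeNat_eq_replicate] using hf.comp (Prod.fst : ι × Prop → ι)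
  · rw [unaryEncodeNat_eq_replicate, update_idem]
    congr 1
    exact update_eq_self_iff.2 rfl

/-- Execute `A` while the entry with index `k` of the vector increases from zero to `bound`, and
reset the entry. -/
def forCounter (k : κ) (A : Program (Reg κ) M) : Program (Reg κ) M :=
  (A.seq (drain (.remaining k) fun _ => (push (.value k) true).seq A)).seq
    (move (.value k) (.remaining k))

theorem update_searchState (x : SearchInput) (found : Prop) (c : κ → ℕ) (k : κ) (n : ℕ) :
    searchState x found (update c k n) =
      update (update (searchState x found c) (.value k) (List.replicate n true))
        (.remaining k) (List.replicate (x.bound - n) true) := by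
  funext r
  cases r <;> grind [searchState, update_apply]

theorem Tests.forCounter {k : κ} {R : ι → ℕ → Prop} (hc : ∀ i, c i k = 0)
    (hA : Tests A (fun p : {p : ι × ℕ // p.2 ≤ (x p.1).bound} => x p.1.1)
      (fun p => update (c p.1.1) k p.1.2) fun p => R p.1.1 p.1.2) :
    Tests (forCounter k A) x c fun i => ∃ n ≤ (x i).bound, R i n := by
  let S (p : ι × Prop) (j : ℕ) : Reg κ → List Bool :=
    searchState (x p.1) (p.2 ∨ ∃ n ≤ j, R p.1 n) (update (c p.1) k j)
  have hbound := polyBounded_bound fun p : ι × Prop => x p.1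
  have first : PolyRuns (fun p : ι × Prop => (x p.1).size) A
      (fun p => searchState (x p.1) p.2 (c p.1)) fun p => S p 0 :=
    (PolyRuns.comp hA fun p : ι × Prop => (⟨(p.1, 0), Nat.zero_le _⟩, p.2)).congr
      (fun p => by simp [← hc p.1]) fun p => by simp [S]
  let Step (b : Bool) : Type _ :=
    {p : (ι × Prop) × ℕ // (List.replicate (x p.1.1).bound true)[p.2]? = some b}
  have lt {b : Bool} (p : Step b) : p.1.2 < (x p.1.1.1).bound := by
    simpa using (List.getElem?_eq_some_iff.1 p.2).1
  have next (b : Bool) : PolyRuns (fun p : Step b => (x p.1.1.1).size)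
      ((push (.value k) true).seq A)
      (fun p => update (S p.1.1 p.1.2) (.remaining k)
        ((List.replicate (x p.1.1.1).bound true).drop (p.1.2 + 1)))
      fun p => S p.1.1 (p.1.2 + 1) := by
    refine (polyRuns_push (.value k) true).seq ((PolyRuns.comp hA fun p : Step b =>
      (⟨(p.1.1.1, p.1.2 + 1), lt p⟩, p.1.1.2 ∨ ∃ n ≤ p.1.2, R p.1.1.1 n)).congr ?_ ?_)
    · intro p
      simp only [S, update_searchState, List.drop_replicate]
      grind [update_apply]
    · intro p
      simp only [S, Nat.le_succ_iff, or_and_right, exists_or, exists_eq_left, or_assoc]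
  have loop := PolyRuns.drain (k := .remaining k) (S := S)
    (L := fun p => List.replicate (x p.1).bound true) (by simpa using hbound)
    (by simp [S, searchState]) next
  refine ((first.seq loop).seq (polyRuns_move (by simp) ?_)).congr (fun _ => rfl) fun p => ?_
  · simpa [S, searchState] using hbound
  · have reset : c p.1 = update (c p.1) k 0 := by simp [← hc p.1]
    conv_rhs => rw [reset]
    simp only [S, List.length_replicate, update_searchState]
    grind [update_apply]

/-- Execute `A` for all vectors that arise from the current one by changing the entries with index
in the list, which have to be zero. -/
def search (A : Program (Reg κ) M) (ks : List κ) : Program (Reg κ) M := ks.foldr forCounter A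

/-- The vectors with entries up to `bound` whose entries with index in the list are zero. -/
abbrev SearchStart {α : Type*} (x : α → SearchInput) (ks : List κ) : Type _ :=
  {p : α × (κ → ℕ) // (∀ k, p.2 k ≤ (x p.1).bound) ∧ ∀ k ∈ ks, p.2 k = 0}

theorem Tests.search {α : Type*} {x : α → SearchInput} {R : α → (κ → ℕ) → Prop}
    (hA : Tests A (fun p : {p : α × (κ → ℕ) // ∀ k, p.2 k ≤ (x p.1).bound} => x p.1.1)
      (fun p => p.1.2) fun p => R p.1.1 p.1.2) :
    ∀ ks : List κ, ks.Nodup → Tests (search A ks)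
      (fun p : SearchStart x ks => x p.1.1) (fun p => p.1.2)
      fun p => ∃ c, (∀ k, c k ≤ (x p.1.1).bound) ∧ (∀ k ∉ ks, c k = p.1.2 k) ∧ R p.1.1 c
  | [], _ => (hA.comp fun p : SearchStart x [] => ⟨p.1, p.2.1⟩).congr fun p =>
      ⟨fun h => ⟨p.1.2, p.2.1, fun _ _ => rfl, h⟩, fun ⟨c, _, hc, h⟩ =>
        (funext fun k => hc k List.not_mem_nil : c = p.1.2) ▸ h⟩
  | k :: ks, hks => by
    let next (q : {q : SearchStart x (k :: ks) × ℕ // q.2 ≤ (x q.1.1.1).bound}) :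
        SearchStart x ks :=
      ⟨(q.1.1.1.1, update q.1.1.1.2 k q.1.2), fun j => by
        have := q.1.1.2.1 j
        grind [update_apply], fun j hj => by grind [update_apply]⟩
    refine (Tests.forCounter (fun p => p.2.2 k List.mem_cons_self)
      (R := fun p n => ∃ c, (∀ k, c k ≤ (x p.1.1).bound) ∧
        (∀ j ∉ ks, c j = update p.1.2 k n j) ∧ R p.1.1 c)
      ((Tests.search hA ks hks.of_cons).comp next)).congr fun p => ⟨?_, ?_⟩
    · rintro ⟨n, -, c, hc, hcn, hR⟩
      exact ⟨c, hc, fun j hj => by grind [update_apply], hR⟩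
    · rintro ⟨c, hc, hcp, hR⟩
      exact ⟨c k, hc k, c, hc, fun j hj => by grind [update_apply], hR⟩

/-- Split the input into its three parts and start with the zero vector. -/
noncomputable def loadInput [Fintype κ] : Program (Reg κ) M :=
  ((readField .input .bound).seq ((readField .input .target).seq (push .answer false))).seq
    (forAll (copy .aux .bound) (Finset.univ.toList.map .remaining))

theorem polyRuns_loadInput [Fintype κ] (x : ι → SearchInput) :
    PolyRuns (K := Reg κ) (M := M) (fun i => (x i).size) loadInput
      (fun i => update (fun _ => []) .input (x i).encode)
      fun i => searchState (x i) False fun _ => 0 := by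
  let afterBound (i : ι) : Reg κ → List Bool
    | .input => encodeField (x i).target ++ (x i).word
    | .bound => List.replicate (x i).bound true
    | _ => []
  let afterTarget (i : ι) : Reg κ → List Bool
    | .input => (x i).word
    | .bound => List.replicate (x i).bound true
    | .target => List.replicate (x i).target true
    | .answer => [false]
    | _ => []
  have read_bound : PolyRuns (M := M) (fun i => (x i).size) (readField .input .bound)
      (fun i => update (fun _ => []) .input (x i).encode) afterBound :=
    (polyRuns_readField (rest := fun i => encodeField (x i).target ++ (x i).word) (by simp)
      (polyBounded_bound x) (by simp [SearchInput.encode]) fun _ => rfl).congr (fun _ => rfl)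
        fun i => by
          funext r
          cases r <;> simp [afterBound]
  have read_target : PolyRuns (M := M) (fun i => (x i).size)
      ((readField .input .target).seq (push .answer false)) afterBound afterTarget := by
    have read := polyRuns_readField (M := M) (T := afterBound) (k := .input) (k' := .target)
      (by simp) (polyBounded_target x) (fun _ => rfl) fun _ => rfl
    refine (read.seq (polyRuns_push .answer false)).congr (fun _ => rfl) fun i => ?_
    funext r
    cases r <;> simp [afterBound, afterTarget]
  have copied := polyRuns_forAll_copy (M := M) (T := afterTarget) (aux := .aux) (k := .bound)
    (by simp) (fun _ => rfl) (by simpa [afterTarget] using polyBounded_bound x)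
    (Finset.univ.toList.map .remaining)
    (by simpa using (Finset.nodup_toList _).map fun _ _ => Reg.remaining.inj)
    (by simp [afterTarget])
  refine ((read_bound.seq read_target).seq copied).congr (fun _ => rfl) fun i => ?_
  funext r
  cases r <;> simp [afterTarget, searchState]

theorem polyTimeSolvable_search [Finite κ] {α : Type} {enc : α → List Bool} {x : α → SearchInput}
    {R : α → (κ → ℕ) → Prop} (henc : ∀ a, enc a = (x a).encode)
    (hA : Tests A (fun p : {p : α × (κ → ℕ) // ∀ k, p.2 k ≤ (x p.1).bound} => x p.1.1)
      (fun p => p.1.2) fun p => R p.1.1 p.1.2) :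
    PolyTimeSolvable enc fun a => ∃ c, (∀ k, c k ≤ (x a).bound) ∧ R a c := by
  classical
  have := Fintype.ofFinite κ
  have searched : Tests (search A Finset.univ.toList) x (fun _ _ => 0)
      fun a => ∃ c, (∀ k, c k ≤ (x a).bound) ∧ R a c :=
    ((Tests.search hA _ (Finset.nodup_toList _)).comp fun a : α =>
      ⟨(a, fun _ => 0), fun _ => Nat.zero_le _, fun _ _ => rfl⟩).congr fun a => by simp
  let others : List (Reg κ) := (Finset.univ.erase .answer).toList
  have cleared := (polyRuns_forAll_clear (M := M)
    (fun r => polyBounded_searchState (x := x) (c := fun _ _ => 0) (fun _ _ => Nat.zero_le _) r)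
    others).comp
      fun a => (a, False ∨ ∃ c, (∀ k, c k ≤ (x a).bound) ∧ R a c)
  refine polyTimeSolvable_of_polyRuns (A := (loadInput.seq (search A Finset.univ.toList)).seq
    (forAll clear others)) (i := .input) (o := .answer) ?_
  simp only [henc]
  refine (((polyRuns_loadInput x).seq (PolyRuns.comp searched fun a => (a, False))).seq
    cleared).congr (fun _ => rfl) fun a => ?_
  funext r
  cases r <;> simp [others, searchState]

end Search

end StackProgram

section Counts

variable {ℓ m : ℕ}

/-- The profile in which every ranking `v` occurs with multiplicity `c v`. -/
noncomputable def profileOfCounts (c : TopRanking ℓ m → ℕ) : Profile ℓ m :=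
  Finset.univ.toList.flatMap fun v => List.replicate (c v) v

theorem length_profileOfCounts (c : TopRanking ℓ m → ℕ) :
    (profileOfCounts c).length = ∑ v, c v := by
  simp only [profileOfCounts, List.length_flatMap, List.length_replicate, Finset.sum_map_toList]

theorem perm_profileOfCounts (P : Profile ℓ m) : P.Perm (profileOfCounts fun v => P.count v) := by
  refine List.perm_iff_count.2 fun v => ?_
  simp [profileOfCounts, List.count_flatMap, Function.comp_def, List.count_replicate]

theorem encodeProfile_append (P Q : Profile ℓ m) :
    encodeProfile (P ++ Q) = encodeProfile P ++ encodeProfile Q :=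
  List.flatMap_append

theorem encodeProfile_profileOfCounts (c : TopRanking ℓ m → ℕ) :
    encodeProfile (profileOfCounts c) = Finset.univ.toList.flatMap fun v =>
      (List.replicate (c v) true).flatMap fun _ => encodeVote v := by
  simp only [encodeProfile, profileOfCounts, List.flatMap_assoc, List.flatMap_replicate]

theorem encodeProfile_ofFn {t : ℕ} (V : Fin t → TopRanking ℓ m) :
    encodeProfile (List.ofFn V) = (List.finRange t).flatMap fun i =>
      (List.finRange ℓ).flatMap fun j => encodeField (V i j) := by
  simp only [encodeProfile, encodeVote, List.ofFn_eq_map, List.flatMap_map]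

theorem wav_iff_exists_counts {r : VotingRule ℓ} (hr : r.Anonymous) {m : ℕ+} {P : Profile ℓ m}
    {t : ℕ} {a : Fin m} :
    r.WAV m P t a ↔ ∃ c : TopRanking ℓ m → ℕ, ∑ v, c v = t ∧ r m (P ++ profileOfCounts c) = a := by
  constructor
  · rintro ⟨P', rfl, rfl⟩
    have h := perm_profileOfCounts P'
    exact ⟨fun v => P'.count v, by rw [← length_profileOfCounts, h.length_eq],
      hr _ _ _ (h.symm.append_left P)⟩
  · rintro ⟨c, rfl, h⟩
    exact ⟨profileOfCounts c, length_profileOfCounts c, h⟩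

theorem wav_iff_exists_ofFn {r : VotingRule ℓ} {m : ℕ+} {P : Profile ℓ m} {t : ℕ} {a : Fin m} :
    r.WAV m P t a ↔ ∃ V : Fin t → TopRanking ℓ m, r m (P ++ List.ofFn V) = a := by
  constructor
  · rintro ⟨P', rfl, h⟩
    exact ⟨P'.get, by rwa [List.ofFn_get]⟩
  · rintro ⟨V, h⟩
    exact ⟨_, List.length_ofFn, h⟩

end Counts

section Solve

open StackProgram

variable {ℓ : ℕ} {κ : Type} [DecidableEq κ] {ι : Type*} {M : Turing.FinTM2}
  {x : ι → SearchInput} {c : ι → κ → ℕ}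

/-- Write the encoding of an election to the register `query`, where `H` writes the number of
candidates, the register `input` contains the known votes, and `W` writes the others. -/
def electionQuery (H W : Program (Reg κ) M) : Program (Reg κ) M :=
  (W.seq (copy .aux .input .query)).seq H

theorem tests_electionQuery {r : VotingRule ℓ} {h : Turing.TM2ComputableInPolyTime
      (encodeElection (ℓ := ℓ)) unaryEncodeNat fun E => (r E.1 E.2 : ℕ)}
    {H W : Program (Reg κ) h.tm} {m : ι → ℕ+} {known other : ∀ i, Profile ℓ (m i)}
    {target : ∀ i, Fin (m i)} (hword : ∀ i, (x i).word = encodeProfile (known i))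
    (htarget : ∀ i, (x i).target = target i) (hc : ∀ i k, c i k ≤ (x i).bound)
    (hm : PolyBounded (fun i => (x i).size) fun i => m i)
    (hH : Prepends (fun p : ι × Prop => (x p.1).size) H .query
      (fun p => searchState (x p.1) p.2 (c p.1)) fun p => encodeField (m p.1))
    (hW : Prepends (fun p : ι × Prop => (x p.1).size) W .query
      (fun p => searchState (x p.1) p.2 (c p.1)) fun p => encodeProfile (other p.1)) :
    Tests (queryTest h (electionQuery H W)) x c
      fun i => r (m i) (known i ++ other i) = target i := by
  have input : Prepends (M := h.tm) (fun p : ι × Prop => (x p.1).size) (copy .aux .input .query)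
      .query (fun p => searchState (x p.1) p.2 (c p.1)) fun p => encodeProfile (known p.1) := by
    simpa only [searchState, hword] using prepends_copy (M := h.tm) (k := Reg.input) (r := .query)
      (aux := .aux) (by simp) (by simp) (by simp) (fun _ => rfl) (polyBounded_searchState hc _)
  have query : Prepends (fun p : ι × Prop => (x p.1).size) (electionQuery H W) .query
      (fun p => searchState (x p.1) p.2 (c p.1))
      fun p => encodeElection ⟨m p.1, known p.1 ++ other p.1⟩ := by
    simpa only [electionQuery, encodeElection, encodeProfile_append] using (hW.seq input).seq hH
  exact (tests_queryTest (a := fun i => (⟨m i, known i ++ other i⟩ : Election ℓ)) query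
    (hm.mono fun i => (Fin.is_lt _).le)).congr fun i => by rw [htarget, ← Fin.ext_iff]

/-- Write the encoding of the profile whose multiplicities are the entries of the current
vector. -/
noncomputable def writeCounts (ℓ m : ℕ) : Program (Reg (TopRanking ℓ m)) M :=
  forAll (fun v => translate .aux (.value v) .query fun _ => encodeVote v) Finset.univ.toList

theorem prepends_writeCounts {m : ℕ} {c : ι → TopRanking ℓ m → ℕ}
    (hc : ∀ i v, c i v ≤ (x i).bound) :
    Prepends (M := M) (fun p : ι × Prop => (x p.1).size) (writeCounts ℓ m) .query
      (fun p => searchState (x p.1) p.2 (c p.1))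
      fun p => encodeProfile (profileOfCounts (c p.1)) := by
  simpa only [writeCounts, searchState, encodeProfile_profileOfCounts] using
    Prepends.forAll (fun v => prepends_translate (M := M) (k := Reg.value v) (r := .query)
      (aux := .aux) (by simp) (by simp) (by simp) (fun _ => encodeVote v) (fun _ => rfl)
      (polyBounded_searchState hc _)) Finset.univ.toList

/-- Write the number in the register `k` as a field. -/
def writeField (k : Reg κ) : Program (Reg κ) M :=
  (pushWord .query [false]).seq (copy .aux k .query)

theorem prepends_writeField {k : Reg κ} (hk : k ∉ ({.aux, .query} : Finset (Reg κ))) {n : ι → ℕ}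
    (hc : ∀ i k, c i k ≤ (x i).bound)
    (hn : ∀ p : ι × Prop, searchState (x p.1) p.2 (c p.1) k = List.replicate (n p.1) true) :
    Prepends (M := M) (fun p : ι × Prop => (x p.1).size) (writeField k) .query
      (fun p => searchState (x p.1) p.2 (c p.1)) fun p => encodeField (n p.1) := by
  simp only [Finset.mem_insert, Finset.mem_singleton, not_or] at hk
  simpa only [writeField, encodeField, unaryEncodeNat_eq_replicate, hn] using
    (prepends_pushWord [false]).seq (prepends_copy (M := M) (aux := .aux) hk.1 (by simp) hk.2
      (fun _ => rfl) (polyBounded_searchState hc k))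

/-- Write the encoding of the profile of `t` votes in which the candidate in place `j` of vote `i`
is the entry `(i, j)` of the current vector. -/
def writeVotes (t ℓ : ℕ) : Program (Reg (Fin t × Fin ℓ)) M :=
  forAll (fun i => forAll (fun j => writeField (.value (i, j))) (List.finRange ℓ)) (List.finRange t)

theorem prepends_writeVotes {t : ℕ} {c : ι → Fin t × Fin ℓ → ℕ} {m : ι → ℕ}
    {V : ∀ i, Fin t → TopRanking ℓ (m i)} (hV : ∀ i k, c i k = V i k.1 k.2)
    (hc : ∀ i k, c i k ≤ (x i).bound) :
    Prepends (M := M) (fun p : ι × Prop => (x p.1).size) (writeVotes t ℓ) .query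
      (fun p => searchState (x p.1) p.2 (c p.1))
      fun p => encodeProfile (List.ofFn (V p.1)) := by
  simp only [encodeProfile_ofFn]
  exact .forAll (fun i => .forAll (fun j => prepends_writeField (k := .value (i, j))
    (n := fun q => V q i j) (by simp) hc
    fun p => congrArg (List.replicate · true) (hV p.1 (i, j))) _) _

theorem polyTimeSolvable_fixedCandidates {r : VotingRule ℓ} (hr : r.Anonymous)
    (hpoly : r.PolyTimeComputable) (m : ℕ+) :
    PolyTimeSolvable (FixedCandidatesInstance.encode (ℓ := ℓ) (m := m))
      fun I => r.WAV m I.known I.absent I.target := by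
  obtain ⟨h⟩ := hpoly
  let x (I : FixedCandidatesInstance ℓ m) : SearchInput :=
    ⟨I.absent, I.target, encodeProfile I.known⟩
  have henc (I : FixedCandidatesInstance ℓ m) : I.encode = (x I).encode := rfl
  let R (I : FixedCandidatesInstance ℓ m) (c : TopRanking ℓ m → ℕ) : Prop :=
    ∑ v, c v = I.absent ∧ r m (I.known ++ profileOfCounts c) = I.target
  let Vector := {p : FixedCandidatesInstance ℓ m × (TopRanking ℓ m → ℕ) //
    ∀ v, p.2 v ≤ (x p.1).bound}
  let Completion := {p : Vector // ∑ v, p.1.2 v = (x p.1.1).bound}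
  have entry_le (p : Completion) : ∀ v, p.1.1.2 v ≤ (x p.1.1.1).bound := p.1.2
  have queried : Tests (queryTest h (electionQuery (pushWord .query (encodeField m))
      (writeCounts ℓ m))) (fun p : Completion => x p.1.1.1) (fun p => p.1.1.2)
      fun p => R p.1.1.1 p.1.1.2 :=
    (tests_electionQuery (m := fun _ => m) (known := fun p => p.1.1.1.known)
      (target := fun p => p.1.1.1.target) (fun _ => rfl) (fun _ => rfl) entry_le
      (polyBounded_const m) (prepends_pushWord _) (prepends_writeCounts entry_le)).congr
        fun p => (and_iff_right p.2).symm
  have tested : Tests (guardSum _) (fun p : Vector => x p.1.1) (fun p => p.1.2)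
      fun p => R p.1.1 p.1.2 :=
    .guardSum (fun p => p.2) queried fun _ hp => hp.1
  convert polyTimeSolvable_search (R := R) henc tested using 2 with I
  rw [wav_iff_exists_counts hr]
  refine exists_congr fun c => (and_iff_right_of_imp fun h v => ?_).symm
  exact (Finset.single_le_sum (f := c) (fun _ _ => Nat.zero_le _) (Finset.mem_univ v)).trans_eq h.1

/-- The pairs of indices whose entries must differ for a vector to list the candidates of `t`
votes; the index `none` stands for the number of candidates. -/
noncomputable def voteConflicts (t ℓ : ℕ) :
    List (Option (Fin t × Fin ℓ) × Option (Fin t × Fin ℓ)) :=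
  Finset.univ.toList.map (fun k => (some k, none)) ++
    ({p | p.2.1 ≠ p.2.2} : Finset (Fin t × Fin ℓ × Fin ℓ)).toList.map
      fun p => (some (p.1, p.2.1), some (p.1, p.2.2))

theorem forall_voteConflicts_iff {t m : ℕ} {c : Fin t × Fin ℓ → ℕ} (hc : ∀ k, c k ≤ m) :
    (∀ p ∈ voteConflicts t ℓ, p.1.elim m c ≠ p.2.elim m c) ↔
      ∃ V : Fin t → TopRanking ℓ m, ∀ k, c k = V k.1 k.2 := by
  constructor
  · intro h
    have lt (k) : c k < m := (hc k).lt_of_ne (h (some k, none) (by simp [voteConflicts]))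
    refine ⟨fun i => ⟨fun j => ⟨c (i, j), lt (i, j)⟩, fun j j' hjj' => ?_⟩, fun _ => rfl⟩
    by_contra hne
    exact h (some (i, j), some (i, j')) (by simp [voteConflicts, hne]) (Fin.ext_iff.1 hjj')
  · rintro ⟨V, hV⟩ p hp
    simp only [voteConflicts, List.mem_append, List.mem_map, Finset.mem_toList, Finset.mem_univ,
      true_and, Finset.mem_filter] at hp
    obtain ⟨k, rfl⟩ | ⟨q, hq, rfl⟩ := hp
    · simpa [hV] using (V k.1 k.2).is_lt.ne
    · simpa [hV, ← Fin.ext_iff] using hq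

theorem polyTimeSolvable_fixedAbsent {r : VotingRule ℓ} (hpoly : r.PolyTimeComputable) (t : ℕ) :
    PolyTimeSolvable (FixedAbsentInstance.encode (ℓ := ℓ))
      fun I => r.WAV I.candidates I.known t I.target := by
  obtain ⟨h⟩ := hpoly
  let x (I : FixedAbsentInstance ℓ) : SearchInput :=
    ⟨I.candidates, I.target, encodeProfile I.known⟩
  have henc (I : FixedAbsentInstance ℓ) : I.encode = (x I).encode := rfl
  let R (I : FixedAbsentInstance ℓ) (c : Fin t × Fin ℓ → ℕ) : Prop :=
    ∃ V : Fin t → TopRanking ℓ I.candidates, (∀ k, c k = V k.1 k.2) ∧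
      r I.candidates (I.known ++ List.ofFn V) = I.target
  let Vector := {p : FixedAbsentInstance ℓ × (Fin t × Fin ℓ → ℕ) // ∀ k, p.2 k ≤ (x p.1).bound}
  let Completion := {p : Vector // ∀ q ∈ voteConflicts t ℓ,
    q.1.elim (x p.1.1).bound p.1.2 ≠ q.2.elim (x p.1.1).bound p.1.2}
  have entry_le (p : Completion) : ∀ k, p.1.1.2 k ≤ (x p.1.1.1).bound := p.1.2
  choose V hV using fun p : Completion => (forall_voteConflicts_iff p.1.2).1 p.2
  have queried : Tests (queryTest h (electionQuery (writeField .bound) (writeVotes t ℓ)))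
      (fun p : Completion => x p.1.1.1) (fun p => p.1.1.2) fun p => R p.1.1.1 p.1.1.2 := by
    refine (tests_electionQuery (m := fun p => p.1.1.1.candidates)
      (known := fun p => p.1.1.1.known) (other := fun p => List.ofFn (V p))
      (target := fun p => p.1.1.1.target) (fun _ => rfl) (fun _ => rfl) entry_le
      (polyBounded_bound _) (prepends_writeField (k := .bound)
        (n := fun p => p.1.1.1.candidates) (by simp) entry_le fun _ => rfl)
      (prepends_writeVotes hV entry_le)).congr fun p => ⟨fun hp => ⟨V p, hV p, hp⟩, ?_⟩
    rintro ⟨V', hV', hp⟩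
    have : V p = V' := by
      ext i j
      exact (hV p (i, j)).symm.trans (hV' (i, j))
    rwa [this]
  have tested : Tests (guardNe (voteConflicts t ℓ) _) (fun p : Vector => x p.1.1)
      (fun p => p.1.2) fun p => R p.1.1 p.1.2 :=
    .guardNe (fun p => p.2) queried fun p ⟨V, hV, _⟩ => (forall_voteConflicts_iff p.2).2 ⟨V, hV⟩
  convert polyTimeSolvable_search (R := R) henc tested using 2 with I
  rw [wav_iff_exists_ofFn]
  constructor
  · rintro ⟨V, hV⟩
    exact ⟨fun k => V k.1 k.2, fun k => (V k.1 k.2).is_lt.le, V, fun _ => rfl, hV⟩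
  · rintro ⟨_, _, V, _, hV⟩
    exact ⟨V, hV⟩

theorem proposition1_general (r : VotingRule ℓ) (hpoly : r.PolyTimeComputable) :
    (r.Anonymous → ∀ m : ℕ+,
      PolyTimeSolvable (FixedCandidatesInstance.encode (ℓ := ℓ) (m := m))
        fun I => r.WAV m I.known I.absent I.target) ∧
    (∀ t : ℕ,
      PolyTimeSolvable (FixedAbsentInstance.encode (ℓ := ℓ))
        fun I => r.WAV I.candidates I.known t I.target) :=
  ⟨fun hr m => polyTimeSolvable_fixedCandidates hr hpoly m, polyTimeSolvable_fixedAbsent hpoly⟩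

end Solve

theorem proposition1 (ℓ : ℕ) (hℓ : 2 ≤ ℓ) (r : VotingRule ℓ) (hr : r.Anonymous)
    (hpoly : r.PolyTimeComputable) :
    (∀ m : ℕ+, 2 ≤ m →
      PolyTimeSolvable (FixedCandidatesInstance.encode (ℓ := ℓ) (m := m))
        fun I => r.WAV m I.known I.absent I.target) ∧
    (∀ t : ℕ,
      PolyTimeSolvable (FixedAbsentInstance.encode (ℓ := ℓ))
        fun I => r.WAV I.candidates I.known t I.target) :=
  ⟨fun m _ => (proposition1_general r hpoly).1 hr m, (proposition1_general r hpoly).2⟩
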